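/- **Setting.** A task consists of a finite state space $\Theta$, a finite action set $A$ and payoff vectors $u(a)\in\mathbb{R}^\Theta$, $a\in A$. A belief is a probability vector $p$ on $\Theta$; an action is optimal under $p$ if it maximizes $\mathbb{E}_p u(a)$. Two distinct actions $a,b$ are *adjacent* if for some belief the set of optimal actions is exactly $\{a,b\}$; the adjacency graph has vertex set $A$ and the adjacent pairs as edges. For $v\in\mathbb{R}^\Theta$ let $\bar v=v-\frac1{|\Theta|}\sum_{\theta}v(\theta)\mathbf 1$ (applied row by row to matrices) and let $\Delta_a^b=\bar u(b)-\bar u(a)$. A question profile $X$ assigns to each $a\in A$ a matrix $X(a)\in\mathbb{R}^{m\times\Theta}$. It is *incentivizable* if there is $V:\mathbb{R}^m\times A\times\Theta\to[0,1]$ such that for every belief $p$ $$\arg\max_{(r,a)}\mathbb{E}_p[V(r,a,\theta)]=\{(\mathbb{E}_pX(a),a): a\in\arg\max_{a'\in A}\mathbb{E}_pu(a')\}.$$ It is *robustly incentivizable* if there are invertible matrices $\mu(a)\in\mathbb{R}^{m\times m}$, $a\in A$, such that for every $t\in\mathbb{R}^{m\times\Theta}$ the profile $a\mapsto X(a)+\mu(a)t$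 is incentivizable. For a finite graph with a fixed orientation of its edges, the cycle space is the kernel of the real vertex-edge incidence matrix (entry $+1$ if the edge enters the vertex, $-1$ if it leaves it, $0$ otherwise). A *cycle basis* is a set of (simple) cycles whose incidence vectors (entry $\pm1$ on an edge of the cycle, according to whether the edge is traversed along or against its orientation) form a basis of the cycle space; it is *minimum* if it minimizes the total length of its cycles. A *block* is a maximal connected subgraph without cut-vertices. **Product problem.** Let $(\Theta_i,A_i,u_i)$, $i\in I$, be finitely many tasks with $|\Theta_i|\ge2$, and let $G_i$ be the adjacency graph of task $i$. Assume that every action of every task is the unique optimal action of that task under some belief on $\Theta_i$. The product problem has $\Theta=\prod_i\Theta_i$, $A=\prod_iA_i$, $u(a,\theta)=\sum_iu_i(a_i,\theta_i)$; its adjacency graph is the Cartesian product of the $G_i$. Write $u_i(a)\in\mathbb{R}^\Theta$ for the vector $\theta\mapsto u_i(a_i,\theta_i)$. **Assumption.** (1) For every 4-cycle of the product graph that moves alternately along an edge of $G_i$ and an edge of $G_j$ ($i\ne j$), the set of the vectors $\Delta_a^b$ over consecutive actions $a,b$ of the cycle has rank $2$. (2) For each $i$ there is a minimum cycle basis of $G_i$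 such that for each of its cycles $C$ the set of the vectors $\Delta_{a_i}^{b_i}$ over consecutive actions $a_i,b_i$ of $C$ has rank $|C|-1$. **Definition.** $X$ is *task-block-wise jointly aligned* with $u$ if there are scalars $\tau_i\in\mathbb{R}$ ($i\in I$), for each $i$ and each block $z$ of $G_i$ a column vector $\lambda_{i,z}\in\mathbb{R}^m$ and a matrix $d_{i,z}\in\mathbb{R}^{m\times\Theta}$, and for each $a\in A$ an invertible matrix $\Gamma(a)\in\mathbb{R}^{m\times m}$, such that $$\bar X(a)=\Gamma(a)\sum_{i}\bigl(\tau_i\lambda_{i,z_i}\bar u_i(a)+\bar d_{i,z_i}\bigr)$$ for every $a\in A$ and every choice of blocks $z_i$ of $G_i$ with $a_i\in z_i$ for all $i\in I$. **Proposition.** Under this assumption, for every $m$ and every question profile $X:A\to\mathbb{R}^{m\times\Theta}$ of the product problem, $X$ is robustly incentivizable if and only if $X$ is task-block-wise jointly aligned with $u$. -/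

import Mathlib

open scoped Matrix

noncomputable section

/-! ### State-contingent tasks and adjacency -/

/-- The action `a` maximizes the expected payoff under the belief `p`. -/
def IsOptimal {Θ A : Type*} [Fintype Θ] (u : A → Θ → ℝ) (p : Θ → ℝ) (a : A) : Prop :=
  ∀ b, p ⬝ᵥ u b ≤ p ⬝ᵥ u a

/-- Every action is the unique optimal action under some belief. -/
def NonRedundant {Θ A : Type*} [Fintype Θ] (u : A → Θ → ℝ) : Prop :=
  ∀ a, ∃ p ∈ stdSimplex ℝ Θ, ∀ b, b ≠ a → p ⬝ᵥ u b < p ⬝ᵥ u a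

/-- Two distinct actions are adjacent if under some belief they are exactly the optimal actions. -/
def adjacencyGraph {Θ A : Type*} [Fintype Θ] (u : A → Θ → ℝ) : SimpleGraph A where
  Adj a b := a ≠ b ∧ ∃ p ∈ stdSimplex ℝ Θ, {c | IsOptimal u p c} = {a, b}
  symm := ⟨fun a b h => by
    obtain ⟨hab, p, hp, h⟩ := h
    exact ⟨hab.symm, p, hp, by rw [h, Set.pair_comm]⟩⟩
  loopless := ⟨fun _ h => h.1 rfl⟩

/-- The projection `v̄` of `v` onto the vectors whose coordinates sum to zero. -/
def center {Θ : Type*} [Fintype Θ] (v : Θ → ℝ) : Θ → ℝ :=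
  fun θ => v θ - (∑ θ', v θ') / (Fintype.card Θ : ℝ)

/-- Centering of every row of a matrix. -/
def centerRows {m : ℕ} {Θ : Type*} [Fintype Θ] (M : Matrix (Fin m) Θ ℝ) : Matrix (Fin m) Θ ℝ :=
  Matrix.of fun j => center (M j)

/-- The payoff difference vector `Δ_a^b = ū(b) - ū(a)`. -/
def payoffDiff {Θ A : Type*} [Fintype Θ] (u : A → Θ → ℝ) (a b : A) : Θ → ℝ :=
  center (u b) - center (u a)

/-! ### Incentivizability -/

/-- The question profile `X` is incentivizable: for some payment rule `V` with values in `[0,1]`,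
under every belief `p` the optimal pairs (report, action) are exactly the pairs consisting of an
optimal action `a` of the task and the true expectation of `X a`. -/
def Incentivizable {m : ℕ} {Θ A : Type*} [Fintype Θ] (u : A → Θ → ℝ)
    (X : A → Matrix (Fin m) Θ ℝ) : Prop :=
  ∃ V : (Fin m → ℝ) → A → Θ → ℝ, (∀ r a θ, V r a θ ∈ Set.Icc (0 : ℝ) 1) ∧
    ∀ p ∈ stdSimplex ℝ Θ,
      {x : (Fin m → ℝ) × A | ∀ r a, p ⬝ᵥ V r a ≤ p ⬝ᵥ V x.1 x.2} =
        {x : (Fin m → ℝ) × A | x.1 = X x.2 *ᵥ p ∧ IsOptimal u p x.2}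

/-- Robust incentivizability. -/
def RobustlyIncentivizable {m : ℕ} {Θ A : Type*} [Fintype Θ] (u : A → Θ → ℝ)
    (X : A → Matrix (Fin m) Θ ℝ) : Prop :=
  ∃ μ : A → Matrix (Fin m) (Fin m) ℝ, (∀ a, IsUnit (μ a)) ∧
    ∀ t : Matrix (Fin m) Θ ℝ, Incentivizable u fun a => X a + μ a * t

/-! ### Cycle bases and blocks of a finite graph -/

/-- The head of an edge, for an arbitrary fixed orientation. -/
def edgeHead {V : Type*} (G : SimpleGraph V) (e : G.edgeSet) : V :=
  (Quot.out (e : Sym2 V)).2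

open Classical in
/-- The vertex-edge incidence matrix: `+1` if `e` enters `v`, `-1` if `e` leaves `v`. -/
def vertexEdgeMatrix {V : Type*} (G : SimpleGraph V) : Matrix V G.edgeSet ℝ :=
  Matrix.of fun v e => if v ∈ (e : Sym2 V) then (if v = edgeHead G e then 1 else -1) else 0

open Classical in
/-- The cycle space, i.e. the kernel of the vertex-edge incidence matrix. -/
def cycleSpace {V : Type*} [Fintype V] (G : SimpleGraph V) : Submodule ℝ (G.edgeSet → ℝ) :=
  LinearMap.ker (vertexEdgeMatrix G).mulVecLin

open Classical in
/-- The incidence vector of a closed walk: an edge contributes `+1` when it is traversed along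
its orientation and `-1` when it is traversed against it. -/
def cycleVector {V : Type*} (G : SimpleGraph V) (c : Σ v, G.Walk v v) : G.edgeSet → ℝ :=
  fun e => (c.2.darts.map fun δ =>
    if δ.edge = (e : Sym2 V) then (if δ.snd = edgeHead G e then (1 : ℝ) else -1) else 0).sum

/-- A cycle basis, each of its cycles being given by a closed walk that runs once around it. -/
def IsCycleBasis {V : Type*} [Fintype V] (G : SimpleGraph V)
    (B : Finset (Σ v, G.Walk v v)) : Prop :=
  (∀ c ∈ B, c.2.IsCycle) ∧
  LinearIndependent ℝ (fun c : B => cycleVector G c.1) ∧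
  Submodule.span ℝ (cycleVector G '' (B : Set (Σ v, G.Walk v v))) = cycleSpace G

/-- A minimum cycle basis. -/
def IsMinCycleBasis {V : Type*} [Fintype V] (G : SimpleGraph V)
    (B : Finset (Σ v, G.Walk v v)) : Prop :=
  IsCycleBasis G B ∧
  ∀ B' : Finset (Σ v, G.Walk v v), IsCycleBasis G B' →
    ∑ c ∈ B, c.2.length ≤ ∑ c ∈ B', c.2.length

/-- A block: a maximal connected subgraph without cut-vertices. -/
def IsBlock {V : Type*} (G : SimpleGraph V) (H : G.Subgraph) : Prop :=
  Maximal (fun K : G.Subgraph =>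
    K.Connected ∧ ∀ v ∈ K.verts, (K.deleteVerts {v}).Preconnected) H

/-- The type of blocks of `G`. -/
abbrev Block {V : Type*} (G : SimpleGraph V) : Type _ := {H : G.Subgraph // IsBlock G H}

/-! ### Product problems -/

/-- The payoff of task `i`, as a vector indexed by the states of the product problem. -/
def taskPayoff {ι : Type*} {Θ A : ι → Type*} (u : ∀ i, A i → Θ i → ℝ) (i : ι)
    (a : ∀ i, A i) : (∀ i, Θ i) → ℝ :=
  fun θ => u i (a i) (θ i)

/-- The payoff `u(a, θ) = ∑ i, u_i(a_i, θ_i)` of the product problem. -/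
def totalPayoff {ι : Type*} [Fintype ι] {Θ A : ι → Type*} (u : ∀ i, A i → Θ i → ℝ)
    (a : ∀ i, A i) : (∀ i, Θ i) → ℝ :=
  fun θ => ∑ i, u i (a i) (θ i)

/-- For every 4-cycle of the product graph that moves alternately along an edge of task `i` and an
edge of task `j`, the four payoff difference vectors have rank `2`. -/
def SquareIndependence {ι : Type*} [Fintype ι] [DecidableEq ι] {Θ A : ι → Type*}
    [∀ i, Fintype (Θ i)] (u : ∀ i, A i → Θ i → ℝ) : Prop :=
  ∀ (i j : ι), i ≠ j → ∀ (a : ∀ i, A i) (x : A i) (y : A j),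
    (adjacencyGraph (u i)).Adj (a i) x → (adjacencyGraph (u j)).Adj (a j) y →
    let a₁ := a
    let a₂ := Function.update a i x
    let a₃ := Function.update (Function.update a i x) j y
    let a₄ := Function.update a j y
    Set.finrank ℝ ({payoffDiff (totalPayoff u) a₁ a₂, payoffDiff (totalPayoff u) a₂ a₃,
      payoffDiff (totalPayoff u) a₃ a₄, payoffDiff (totalPayoff u) a₄ a₁} :
        Set ((∀ i, Θ i) → ℝ)) = 2

/-- The adjacency graph of the task has a minimum cycle basis such that, for each of its cycles
`C`, the payoff difference vectors along `C` have rank `|C| - 1`. -/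
def CycleIndependence {Θ A : Type*} [Fintype Θ] [Fintype A] (u : A → Θ → ℝ) : Prop :=
  ∃ B : Finset (Σ v, (adjacencyGraph u).Walk v v), IsMinCycleBasis (adjacencyGraph u) B ∧
    ∀ c ∈ B, Set.finrank ℝ {w : Θ → ℝ | ∃ δ ∈ c.2.darts, w = payoffDiff u δ.fst δ.snd} + 1 =
      c.2.length

/-- Task-block-wise joint alignment: the equation is required for every choice of blocks
`z i`, one for each task, such that `a i` lies in `z i` for all `i`. -/
def TaskBlockwiseJointlyAligned {m : ℕ} {ι : Type*} [Fintype ι] [DecidableEq ι]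
    {Θ A : ι → Type*} [∀ i, Fintype (Θ i)] (u : ∀ i, A i → Θ i → ℝ)
    (X : (∀ i, A i) → Matrix (Fin m) (∀ i, Θ i) ℝ) : Prop :=
  ∃ (τ : ι → ℝ) (lam : ∀ i, Block (adjacencyGraph (u i)) → Fin m → ℝ)
    (d : ∀ i, Block (adjacencyGraph (u i)) → Matrix (Fin m) (∀ i, Θ i) ℝ)
    (Γ : (∀ i, A i) → Matrix (Fin m) (Fin m) ℝ),
    (∀ a, IsUnit (Γ a)) ∧
    ∀ (a : ∀ i, A i) (z : ∀ i, Block (adjacencyGraph (u i))),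
      (∀ i, a i ∈ (z i).1.verts) →
      centerRows (X a) = Γ a * ∑ i,
        (τ i • Matrix.vecMulVec (lam i (z i)) (center (taskPayoff u i a)) +
          centerRows (d i (z i)))

end

open scoped Matrix

noncomputable section

set_option linter.unusedSectionVars false

/-! ### Beliefs and the improvement property of the adjacency graph -/

section Beliefs

variable {Θ A : Type*} [Fintype Θ] {u : A → Θ → ℝ}

/-! Both properties are equivalent to an edge condition. After multiplication by suitable invertible
matrices Γ(a)⁻¹, the centered profile is a sum of functions f_i(a_i), each varying along every edge
of G_i by λΔ with a vector λ depending on the edge.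

Robust incentivizability gives such increments by choosing the shift t that makes the question at a
trivial. Near a belief where exactly a and b are optimal, a fixed report for b has expected payment
affine in the belief. On the indifference hyperplane it stays below the payment of the trivial
question and touches it at an interior point, so the two agree and the answer for b cannot vary
there (`Incentivizable.mulVec_eq_zero`). Centered payoff differences of distinct tasks are
independent, so mixed second differences vanish around 4-cycles and connectedness gives the sum
(`sub_eq_sum_of_forall_adj`).

Within a task, closing up a basis cycle C gives two relations among its vectors Δ: with coefficients
1 and with the edge coefficients s. Rank |C|-1 forces s to be constant on C. Thus for any real
function m of the action, s·(m(y)-m(x)) sums to zero on basis cycles, hence on all closed walks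
(`CycleIndependence.sum_darts_eq_zero`). Taking m to be a vertex indicator makes s constant on
blocks (`IsBlock.weight_eq`), which is alignment.

Conversely, alignment yields the edge condition for centered payoffs. Taking m to be the mean payoff
provides the additive constants that turn it into a condition on the payoffs themselves. A quadratic
score plus a large multiple of the payoff then works (`incentivizable_of_sub_eq`): improving paths
in the adjacency graph bound the possible loss in the quadratic part by a multiple of the payoff
gap. -/

theorem isOptimal_smul_iff {p : Θ → ℝ} {c : ℝ} (hc : 0 < c) {a : A} :
    IsOptimal u (c • p) a ↔ IsOptimal u p a := by
  simp only [IsOptimal, smul_dotProduct, smul_eq_mul, mul_le_mul_iff_right₀ hc]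

theorem exists_smul_mem_stdSimplex {p : Θ → ℝ} (hp : ∀ θ, 0 ≤ p θ) (hp' : p ≠ 0) :
    ∃ c : ℝ, 0 < c ∧ c • p ∈ stdSimplex ℝ Θ := by
  have hs : 0 < ∑ θ, p θ := by
    refine lt_of_le_of_ne (Finset.sum_nonneg fun θ _ => hp θ) fun h => hp' ?_
    funext θ
    exact (Finset.sum_eq_zero_iff_of_nonneg fun θ _ => hp θ).1 h.symm θ (Finset.mem_univ θ)
  refine ⟨(∑ θ, p θ)⁻¹, inv_pos.2 hs, fun θ => ?_, ?_⟩
  · exact mul_nonneg (inv_pos.2 hs).le (hp θ)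
  · simp only [Pi.smul_apply, smul_eq_mul, ← Finset.mul_sum]
    exact inv_mul_cancel₀ hs.ne'

theorem tendsto_dotProduct_add_smul (p q v : Θ → ℝ) :
    Filter.Tendsto (fun ε : ℝ => (p + ε • q) ⬝ᵥ v) (nhds 0) (nhds (p ⬝ᵥ v)) := by
  have : Continuous fun ε : ℝ => (p + ε • q) ⬝ᵥ v := by
    simp only [add_dotProduct, smul_dotProduct]
    fun_prop
  simpa using this.tendsto 0

theorem tendsto_apply_add_smul (p q : Θ → ℝ) (θ : Θ) :
    Filter.Tendsto (fun ε : ℝ => (p + ε • q) θ) (nhds 0) (nhds (p θ)) := by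
  have : Continuous fun ε : ℝ => (p + ε • q) θ := by
    simp only [Pi.add_apply, Pi.smul_apply]
    fun_prop
  simpa using this.tendsto 0

/-- Strict preferences survive small perturbations of the belief. -/
theorem eventually_forall_dotProduct_lt [Finite A] {p : Θ → ℝ} (q : Θ → ℝ) {a : A} {S : Set A}
    (h : ∀ c ∈ S, p ⬝ᵥ u c < p ⬝ᵥ u a) :
    ∀ᶠ ε : ℝ in nhds 0, ∀ c ∈ S, (p + ε • q) ⬝ᵥ u c < (p + ε • q) ⬝ᵥ u a := by
  rw [Filter.eventually_all]
  intro c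
  by_cases hc : c ∈ S
  · filter_upwards [(tendsto_dotProduct_add_smul p q (u c)).eventually_lt
      (tendsto_dotProduct_add_smul p q (u a)) (h c hc)] with ε hε _ using hε
  · exact Filter.Eventually.of_forall fun ε hc' => absurd hc' hc

theorem eventually_forall_pos {p : Θ → ℝ} (q : Θ → ℝ) (h : ∀ θ, 0 < p θ) :
    ∀ᶠ ε : ℝ in nhds 0, ∀ θ, 0 < (p + ε • q) θ := by
  rw [Filter.eventually_all]
  exact fun θ => (tendsto_apply_add_smul p q θ).eventually_const_lt (h θ)

theorem exists_pos_of_eventually_nhds {P : ℝ → Prop} (h : ∀ᶠ ε in nhds (0 : ℝ), P ε) :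
    ∃ ε, 0 < ε ∧ P ε := by
  have h1 : ∀ᶠ ε in nhdsWithin (0 : ℝ) (Set.Ioi 0), P ε := h.filter_mono nhdsWithin_le_nhds
  obtain ⟨ε, h2, h3⟩ := (h1.and self_mem_nhdsWithin).exists
  exact ⟨ε, h3, h2⟩

/-- Adjacency can be tested with nonnegative vectors that are not normalized. -/
theorem adjacencyGraph_adj_of_nonneg {a b : A} (hab : a ≠ b) {p : Θ → ℝ} (hp : ∀ θ, 0 ≤ p θ)
    (hp' : p ≠ 0) (h : {c | IsOptimal u p c} = {a, b}) : (adjacencyGraph u).Adj a b := by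
  obtain ⟨c, hc, hcp⟩ := exists_smul_mem_stdSimplex hp hp'
  refine ⟨hab, c • p, hcp, ?_⟩
  simpa only [isOptimal_smul_iff hc] using h

theorem dotProduct_lt_of_forall_ne {p : Θ → ℝ} {a b : A} (h : ∀ b, b ≠ a → p ⬝ᵥ u b < p ⬝ᵥ u a)
    (hab : a ≠ b) : 0 < p ⬝ᵥ (u a - u b) := by
  rw [dotProduct_sub, sub_pos]
  exact h b hab.symm

theorem setOf_isOptimal_eq_pair {p : Θ → ℝ} {a b : A} (hab : p ⬝ᵥ u a = p ⬝ᵥ u b)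
    (h : ∀ c ∈ ({a, b} : Set A)ᶜ, p ⬝ᵥ u c < p ⬝ᵥ u a) : {c | IsOptimal u p c} = {a, b} := by
  have ha : ∀ c, p ⬝ᵥ u c ≤ p ⬝ᵥ u a := by
    intro c
    by_cases hc : c ∈ ({a, b} : Set A)
    · rcases hc with rfl | rfl
      · exact le_rfl
      · exact hab.ge
    · exact (h c hc).le
  ext c
  constructor
  · intro hc
    by_contra hc'
    exact absurd (hc a) (not_le.2 (h c hc'))
  · rintro (rfl | rfl)
    · exact ha
    · exact fun c => (ha c).trans hab.le

/-- A full-support belief under which exactly the two given adjacent actions are optimal. -/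
theorem exists_pos_belief_of_adj [Finite A] [Nonempty Θ] (hu : NonRedundant u) {a b : A}
    (hab : (adjacencyGraph u).Adj a b) :
    ∃ p ∈ stdSimplex ℝ Θ, (∀ θ, 0 < p θ) ∧ p ⬝ᵥ u a = p ⬝ᵥ u b ∧
      ∀ c ∈ ({a, b} : Set A)ᶜ, p ⬝ᵥ u c < p ⬝ᵥ u a := by
  obtain ⟨hne, p, hp, hopt⟩ := hab
  have ha : IsOptimal u p a := hopt.ge (by simp)
  have hb : IsOptimal u p b := hopt.ge (by simp)
  have hlt : ∀ c ∈ ({a, b} : Set A)ᶜ, p ⬝ᵥ u c < p ⬝ᵥ u a := by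
    intro c hc
    refine lt_of_le_of_ne (ha c) fun h => hc (hopt.le ?_)
    exact fun d => (ha d).trans h.ge
  -- Tilt the all-ones vector towards a belief favouring `a`, just enough to cancel the advantage of
  -- `b`; the result is strictly positive. The opposite sign is the same with the roles exchanged.
  have key : ∀ a b : A, a ≠ b → 0 ≤ (1 : Θ → ℝ) ⬝ᵥ (u b - u a) →
      ∃ q : Θ → ℝ, (∀ θ, 0 < q θ) ∧ q ⬝ᵥ (u b - u a) = 0 := by
    intro a b hne hs
    obtain ⟨r, hr, hra⟩ := hu a
    have hpos := dotProduct_lt_of_forall_ne hra hne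
    refine ⟨1 + (((1 : Θ → ℝ) ⬝ᵥ (u b - u a)) / (r ⬝ᵥ (u a - u b))) • r, fun θ => ?_, ?_⟩
    · have : 0 ≤ (((1 : Θ → ℝ) ⬝ᵥ (u b - u a)) / (r ⬝ᵥ (u a - u b))) * r θ :=
        mul_nonneg (div_nonneg hs hpos.le) (hr.1 θ)
      simp only [Pi.add_apply, Pi.one_apply, Pi.smul_apply, smul_eq_mul]
      linarith
    · have : r ⬝ᵥ (u b - u a) = -(r ⬝ᵥ (u a - u b)) := by
        rw [← dotProduct_neg, neg_sub]
      rw [add_dotProduct, smul_dotProduct, this, smul_eq_mul]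
      field_simp
      ring
  obtain ⟨q, hq, hq0⟩ : ∃ q : Θ → ℝ, (∀ θ, 0 < q θ) ∧ q ⬝ᵥ (u b - u a) = 0 := by
    rcases le_total 0 ((1 : Θ → ℝ) ⬝ᵥ (u b - u a)) with h | h
    · exact key a b hne h
    · obtain ⟨q, hq, hq0⟩ := key b a hne.symm (by
        rw [← neg_sub, dotProduct_neg]; linarith)
      exact ⟨q, hq, by rw [← neg_sub, dotProduct_neg, hq0, neg_zero]⟩
  obtain ⟨ε, hε, hε'⟩ := exists_pos_of_eventually_nhds (eventually_forall_dotProduct_lt q hlt)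
  have hpos : ∀ θ, 0 < (p + ε • q) θ := fun θ =>
    add_pos_of_nonneg_of_pos (hp.1 θ) (mul_pos hε (hq θ))
  have hne0 : p + ε • q ≠ 0 := by
    intro h
    obtain ⟨θ⟩ := ‹Nonempty Θ›
    exact (hpos θ).ne' (congrFun h θ)
  obtain ⟨c, hc, hcp⟩ := exists_smul_mem_stdSimplex (fun θ => (hpos θ).le) hne0
  refine ⟨_, hcp, fun θ => mul_pos hc (hpos θ), ?_, fun d hd => ?_⟩
  · have h1 : p ⬝ᵥ u a = p ⬝ᵥ u b := le_antisymm (hb a) (ha b)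
    rw [dotProduct_sub, sub_eq_zero] at hq0
    simp only [smul_dotProduct, add_dotProduct, h1, hq0]
  · simp only [smul_dotProduct, smul_eq_mul]
    exact mul_lt_mul_of_pos_left (hε' d hd) hc

/-- Under a belief that makes both `b` and `c` better than `a`, the two payoff gains are not
proportional with the factor given by the belief. -/
theorem exists_dotProduct_mul_ne (hu : NonRedundant u) {a b c : A} (hab : a ≠ b) (hac : a ≠ c)
    (hbc : b ≠ c) {p : Θ → ℝ} (hb : 0 < p ⬝ᵥ (u b - u a)) (hc : 0 < p ⬝ᵥ (u c - u a)) :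
    ∃ r : Θ → ℝ, (p ⬝ᵥ (u c - u a)) * (r ⬝ᵥ (u b - u a)) -
      (p ⬝ᵥ (u b - u a)) * (r ⬝ᵥ (u c - u a)) ≠ 0 := by
  by_contra! h
  obtain ⟨r, -, hr⟩ := hu b
  obtain ⟨s, -, hs⟩ := hu c
  -- If the gains were proportional under every vector, the belief singling out `b` would force the
  -- gain of `b` at `p` to exceed that of `c`, and the belief singling out `c` the reverse.
  have r1 := dotProduct_lt_of_forall_ne hr hab.symm
  have r2 := dotProduct_lt_of_forall_ne hr hbc
  have s1 := dotProduct_lt_of_forall_ne hs hac.symm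
  have s2 := dotProduct_lt_of_forall_ne hs hbc.symm
  have e1 := h r
  have e2 := h s
  simp only [dotProduct_sub] at *
  have k1 : p ⬝ᵥ u c - p ⬝ᵥ u a < p ⬝ᵥ u b - p ⬝ᵥ u a := by
    by_contra! hcon
    nlinarith
  have k2 : p ⬝ᵥ u b - p ⬝ᵥ u a < p ⬝ᵥ u c - p ⬝ᵥ u a := by
    by_contra! hcon
    nlinarith
  exact lt_asymm k1 k2

/-- An action that is not optimal can be improved upon by an adjacent action. -/
theorem exists_adj_dotProduct_lt [Finite A] [Nonempty Θ] (hu : NonRedundant u) {p : Θ → ℝ}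
    (hp : ∀ θ, 0 ≤ p θ) {a : A} (ha : ¬ IsOptimal u p a) :
    ∃ b, (adjacencyGraph u).Adj a b ∧ p ⬝ᵥ u a < p ⬝ᵥ u b := by
  classical
  have := Fintype.ofFinite A
  obtain ⟨q₀, hq₀, hqa⟩ := hu a
  obtain ⟨ε, hε, hqa1⟩ := exists_pos_of_eventually_nhds
    (eventually_forall_dotProduct_lt (S := {a}ᶜ) 1 fun b hb => hqa b hb)
  have hq1 : ∀ θ, 0 < (q₀ + ε • (1 : Θ → ℝ)) θ := fun θ =>
    add_pos_of_nonneg_of_pos (hq₀.1 θ) (by simpa using hε)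
  set q₁ := q₀ + ε • (1 : Θ → ℝ)
  -- A zero of `f x` at `q` says that both actions of the pair catch up with `a` at the same point
  -- of the ray `q + s • p`. A generic `q` near `q₁` avoids this for all pairs.
  let T := {x : A × A // x.1 ≠ x.2 ∧ 0 < p ⬝ᵥ (u x.1 - u a) ∧ 0 < p ⬝ᵥ (u x.2 - u a)}
  let f : T → Module.Dual ℝ (Θ → ℝ) := fun x =>
    (dotProductBilin ℝ ℝ).flip ((p ⬝ᵥ (u x.1.2 - u a)) • (u x.1.1 - u a) -
      (p ⬝ᵥ (u x.1.1 - u a)) • (u x.1.2 - u a))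
  have hf : ∀ x r, f x r = (p ⬝ᵥ (u x.1.2 - u a)) * (r ⬝ᵥ (u x.1.1 - u a)) -
      (p ⬝ᵥ (u x.1.1 - u a)) * (r ⬝ᵥ (u x.1.2 - u a)) := by
    intro x r
    change r ⬝ᵥ _ = _
    rw [dotProduct_sub, dotProduct_smul, dotProduct_smul, smul_eq_mul, smul_eq_mul]
  have hne : ∀ {b}, 0 < p ⬝ᵥ (u b - u a) → a ≠ b := by
    rintro b hb rfl
    simp at hb
  obtain ⟨q', hq'⟩ := Module.Dual.exists_forall_ne_zero_of_forall_exists f fun x => by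
    obtain ⟨r, hr⟩ := exists_dotProduct_mul_ne hu (hne x.2.2.1) (hne x.2.2.2) x.2.1 x.2.2.1 x.2.2.2
    exact ⟨r, by rwa [hf]⟩
  have hgen : ∀ x, ∀ᶠ δ : ℝ in nhdsWithin 0 (Set.Ioi 0), f x (q₁ + δ • q') ≠ 0 := by
    intro x
    by_cases h : f x q₁ = 0
    · filter_upwards [self_mem_nhdsWithin] with δ hδ
      rw [map_add, map_smul, h, zero_add, smul_eq_mul]
      exact mul_ne_zero (ne_of_gt hδ) (hq' x)
    · refine Filter.Eventually.filter_mono nhdsWithin_le_nhds ?_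
      have : Continuous fun δ : ℝ => f x (q₁ + δ • q') := by
        simp only [map_add, map_smul, smul_eq_mul]
        fun_prop
      exact this.continuousAt.eventually_ne (by simpa using h)
  obtain ⟨δ, hδ, hδa, hδpos⟩ := ((Filter.eventually_all.2 hgen).and
    (((eventually_forall_dotProduct_lt (S := {a}ᶜ) q' hqa1).and
      (eventually_forall_pos q' hq1)).filter_mono nhdsWithin_le_nhds)).exists
  set q := q₁ + δ • q'
  have hneg : ∀ c, c ≠ a → q ⬝ᵥ (u c - u a) < 0 := fun c hc => by
    rw [dotProduct_sub, sub_neg]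
    exact hδa c hc
  simp only [IsOptimal, not_forall, not_le] at ha
  obtain ⟨b₀, hb₀⟩ := ha
  -- Ratio test of the simplex method: moving from `q`, where `a` is strictly best, in direction
  -- `p`, the minimizer is the first action to tie with `a`. Genericity makes it the only one, so it
  -- is adjacent.
  obtain ⟨b, hb, hmin⟩ := Finset.exists_min_image
    (Finset.univ.filter fun c => 0 < p ⬝ᵥ (u c - u a))
    (fun c => -(q ⬝ᵥ (u c - u a)) / (p ⬝ᵥ (u c - u a)))
    ⟨b₀, by simpa [dotProduct_sub] using hb₀⟩
  simp only [Finset.mem_filter, Finset.mem_univ, true_and] at hb hmin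
  set s := -(q ⬝ᵥ (u b - u a)) / (p ⬝ᵥ (u b - u a)) with hs
  have hs0 : 0 < s := div_pos (neg_pos.2 (hneg b (hne hb).symm)) hb
  have hsb : s * (p ⬝ᵥ (u b - u a)) = -(q ⬝ᵥ (u b - u a)) := div_mul_cancel₀ _ hb.ne'
  refine ⟨b, adjacencyGraph_adj_of_nonneg (p := q + s • p) (hne hb)
    (fun θ => add_nonneg (hδpos θ).le (mul_nonneg hs0.le (hp θ))) ?_ ?_, ?_⟩
  · intro h
    obtain ⟨θ⟩ := ‹Nonempty Θ›
    exact (add_pos_of_pos_of_nonneg (hδpos θ) (mul_nonneg hs0.le (hp θ))).ne' (congrFun h θ)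
  · refine setOf_isOptimal_eq_pair ?_ fun c hc => ?_
    · rw [eq_comm, ← sub_eq_zero, ← dotProduct_sub, add_dotProduct, smul_dotProduct, smul_eq_mul,
        hsb]
      ring
    · simp only [Set.mem_compl_iff, Set.mem_insert_iff, Set.mem_singleton_iff, not_or] at hc
      rw [← sub_neg, ← dotProduct_sub, add_dotProduct, smul_dotProduct, smul_eq_mul]
      by_cases hpc : 0 < p ⬝ᵥ (u c - u a)
      · have h1 := hmin c hpc
        rw [le_div_iff₀ hpc] at h1
        refine lt_of_le_of_ne (by linarith) fun h => ?_
        refine hδ ⟨(c, b), hc.2, hpc, hb⟩ ?_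
        rw [hf]
        linear_combination (p ⬝ᵥ (u b - u a)) * h - (p ⬝ᵥ (u c - u a)) * hsb
      · have h1 := hneg c hc.1
        nlinarith [not_lt.1 hpc]
  · rwa [dotProduct_sub, sub_pos] at hb

theorem wellFounded_dotProduct_lt [Finite A] (p : Θ → ℝ) :
    WellFounded fun b a : A => p ⬝ᵥ u a < p ⬝ᵥ u b := by
  have : IsTrans A fun b a : A => p ⬝ᵥ u a < p ⬝ᵥ u b := ⟨fun _ _ _ h1 h2 => h2.trans h1⟩
  have : Std.Irrefl fun b a : A => p ⬝ᵥ u a < p ⬝ᵥ u b := ⟨fun _ => lt_irrefl _⟩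
  exact Finite.wellFounded_of_trans_of_irrefl _

/-- The adjacency graph is connected. -/
theorem adjacencyGraph_preconnected [Finite A] [Nonempty Θ] (hu : NonRedundant u) :
    (adjacencyGraph u).Preconnected := by
  intro a b
  obtain ⟨p, hp, hpb⟩ := hu b
  induction a using (wellFounded_dotProduct_lt (u := u) p).induction with
  | _ a ih =>
    by_cases hab : a = b
    · exact hab ▸ .rfl
    · obtain ⟨c, hac, hlt⟩ := exists_adj_dotProduct_lt hu hp.1
        (fun h : IsOptimal u p a => absurd (h b) (not_le.2 (hpb a hab)))
      exact hac.reachable.trans (ih c hlt)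

/-- A function of the action whose variation along improving edges is bounded by a multiple of the
payoff gain satisfies the same bound between any action and a uniquely optimal action. -/
theorem abs_sub_le_of_unique_optimal [Finite A] [Nonempty Θ] (hu : NonRedundant u) {p : Θ → ℝ}
    (hp : ∀ θ, 0 ≤ p θ) {b : A} (hb : ∀ c, c ≠ b → p ⬝ᵥ u c < p ⬝ᵥ u b) {Z : A → ℝ} {K : ℝ}
    (hZ : ∀ a c, (adjacencyGraph u).Adj a c → p ⬝ᵥ u a < p ⬝ᵥ u c →
      |Z c - Z a| ≤ K * (p ⬝ᵥ u c - p ⬝ᵥ u a)) (a : A) :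
    |Z b - Z a| ≤ K * (p ⬝ᵥ u b - p ⬝ᵥ u a) := by
  induction a using (wellFounded_dotProduct_lt (u := u) p).induction with
  | _ a ih =>
    by_cases hab : a = b
    · simp [hab]
    · obtain ⟨c, hac, hlt⟩ := exists_adj_dotProduct_lt hu hp
        (fun h : IsOptimal u p a => absurd (h b) (not_le.2 (hb a hab)))
      calc |Z b - Z a| = |(Z b - Z c) + (Z c - Z a)| := by ring_nf
        _ ≤ |Z b - Z c| + |Z c - Z a| := abs_add_le _ _
        _ ≤ _ := by linarith [ih c hlt, hZ a c hac hlt]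

/-- The bound of the previous lemma for an action that is optimal but not uniquely so. -/
theorem abs_dotProduct_sub_le_of_isOptimal [Finite A] [Nonempty Θ] (hu : NonRedundant u)
    {p : Θ → ℝ} (hp : ∀ θ, 0 ≤ p θ) {b : A} (hb : IsOptimal u p b) {y : A → Θ → ℝ} {K : ℝ}
    (hy : ∀ a c, (adjacencyGraph u).Adj a c → ∃ s : ℝ, |s| ≤ K ∧ y c - y a = s • (u c - u a))
    (a : A) : |p ⬝ᵥ y b - p ⬝ᵥ y a| ≤ K * (p ⬝ᵥ u b - p ⬝ᵥ u a) := by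
  obtain ⟨r, hr, hrb⟩ := hu b
  -- Mixing in `r` makes `b` uniquely optimal, so the strict version applies; the bound survives the
  -- limit ε → 0.
  have h : ∀ ε : ℝ, 0 < ε → |(p + ε • r) ⬝ᵥ (y b - y a)| ≤ K * ((p + ε • r) ⬝ᵥ (u b - u a)) := by
    intro ε hε
    have := abs_sub_le_of_unique_optimal hu (p := p + ε • r) (b := b) (K := K)
      (Z := fun a => (p + ε • r) ⬝ᵥ y a)
      (fun θ => add_nonneg (hp θ) (mul_nonneg hε.le (hr.1 θ))) (fun c hc => ?_) (fun a c hac hlt => ?_) a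
    · simpa only [dotProduct_sub] using this
    · simp only [add_dotProduct, smul_dotProduct, smul_eq_mul]
      nlinarith [hb c, hrb c hc]
    · obtain ⟨s, hs, hsy⟩ := hy a c hac
      rw [← dotProduct_sub, hsy, dotProduct_smul, smul_eq_mul, abs_mul, ← dotProduct_sub]
      rw [← sub_pos, ← dotProduct_sub] at hlt
      rw [abs_of_pos hlt]
      exact mul_le_mul_of_nonneg_right hs hlt.le
  have h1 := (tendsto_dotProduct_add_smul p r (y b - y a)).abs.mono_left
    (nhdsWithin_le_nhds (s := Set.Ioi 0))
  have h2 := ((tendsto_dotProduct_add_smul p r (u b - u a)).const_mul K).mono_left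
    (nhdsWithin_le_nhds (s := Set.Ioi 0))
  have := le_of_tendsto_of_tendsto h1 h2
    (Filter.eventually_of_mem self_mem_nhdsWithin fun ε hε => h ε hε)
  simpa only [dotProduct_sub] using this

end Beliefs

/-! ### Centering -/

section Center

variable {Θ : Type*} [Fintype Θ]

theorem center_sub (v w : Θ → ℝ) : center (v - w) = center v - center w := by
  funext θ
  simp only [center, Pi.sub_apply, Finset.sum_sub_distrib]
  ring

theorem center_add (v w : Θ → ℝ) : center (v + w) = center v + center w := by
  funext θ
  simp only [center, Pi.add_apply, Finset.sum_add_distrib]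
  ring

theorem center_smul (c : ℝ) (v : Θ → ℝ) : center (c • v) = c • center v := by
  funext θ
  simp only [center, Pi.smul_apply, smul_eq_mul, ← Finset.mul_sum]
  ring

/-- Centering as a linear map. -/
def centerLinearMap (Θ : Type*) [Fintype Θ] : (Θ → ℝ) →ₗ[ℝ] Θ → ℝ where
  toFun := center
  map_add' := center_add
  map_smul' := center_smul

theorem center_sum {ι : Type*} (t : Finset ι) (v : ι → Θ → ℝ) :
    center (∑ i ∈ t, v i) = ∑ i ∈ t, center (v i) :=
  map_sum (centerLinearMap Θ) v t

theorem center_const [Nonempty Θ] (c : ℝ) : center (fun _ : Θ => c) = 0 := by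
  funext θ
  have : (Fintype.card Θ : ℝ) ≠ 0 := by simp
  simp only [center, Finset.sum_const, Finset.card_univ, nsmul_eq_mul, Pi.zero_apply]
  field_simp
  ring

theorem center_center [Nonempty Θ] (v : Θ → ℝ) : center (center v) = center v := by
  have : center v = v - fun _ => (∑ θ', v θ') / (Fintype.card Θ : ℝ) := rfl
  conv_lhs => rw [this, center_sub, center_const, sub_zero]

theorem sum_center [Nonempty Θ] (v : Θ → ℝ) : ∑ θ, center v θ = 0 := by
  have : (Fintype.card Θ : ℝ) ≠ 0 := by simp
  simp only [center, Finset.sum_sub_distrib, Finset.sum_const, Finset.card_univ, nsmul_eq_mul]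
  field_simp
  ring

theorem eq_const_of_center_eq_zero {v : Θ → ℝ} (h : center v = 0) : ∃ c, v = fun _ => c :=
  ⟨_, funext fun θ => sub_eq_zero.1 (congrFun h θ)⟩

theorem eq_center_add_const (v : Θ → ℝ) (θ : Θ) :
    v θ = center v θ + (∑ θ', v θ') / (Fintype.card Θ : ℝ) :=
  (sub_add_cancel _ _).symm

theorem center_dotProduct (v h : Θ → ℝ) (hh : ∑ θ, h θ = 0) : center v ⬝ᵥ h = v ⬝ᵥ h := by
  simp only [dotProduct, center, sub_mul, Finset.sum_sub_distrib, ← Finset.mul_sum, hh, mul_zero,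
    sub_zero]

theorem payoffDiff_eq_center {A : Type*} (u : A → Θ → ℝ) (a b : A) :
    payoffDiff u a b = center (u b - u a) := (center_sub _ _).symm

theorem centerRows_sub {m : ℕ} (M N : Matrix (Fin m) Θ ℝ) :
    centerRows (M - N) = centerRows M - centerRows N :=
  Matrix.ext fun j θ => congrFun (center_sub (M j) (N j)) θ

theorem centerRows_centerRows {m : ℕ} [Nonempty Θ] (M : Matrix (Fin m) Θ ℝ) :
    centerRows (centerRows M) = centerRows M :=
  Matrix.ext fun j θ => congrFun (center_center (M j)) θ

theorem centerRows_mul {m : ℕ} (M : Matrix (Fin m) (Fin m) ℝ) (N : Matrix (Fin m) Θ ℝ) :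
    centerRows (M * N) = M * centerRows N := by
  ext j θ
  simp only [centerRows, Matrix.of_apply, center, Matrix.mul_apply, mul_sub,
    Finset.sum_sub_distrib, sub_right_inj]
  rw [Finset.sum_comm, Finset.sum_div]
  simp only [← Finset.mul_sum, mul_div_assoc]

/-- A vector that is orthogonal to every centered vector orthogonal to `w` is, up to a constant, a
multiple of `w`. -/
theorem exists_center_eq_smul [Nonempty Θ] {v w : Θ → ℝ}
    (h : ∀ x : Θ → ℝ, ∑ θ, x θ = 0 → x ⬝ᵥ w = 0 → v ⬝ᵥ x = 0) :
    ∃ s : ℝ, center v = s • center w := by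
  by_cases hw : center w = 0
  · refine ⟨0, ?_⟩
    have hv : v ⬝ᵥ center v = 0 := h _ (sum_center v) (by
      rw [dotProduct_comm, ← center_dotProduct w _ (sum_center v), hw, zero_dotProduct])
    rw [← center_dotProduct v _ (sum_center v), dotProduct_self_eq_zero] at hv
    rw [hv, zero_smul]
  · have hne : center w ⬝ᵥ center w ≠ 0 := fun h0 => hw (dotProduct_self_eq_zero.1 h0)
    -- The test vector is the residual of projecting the centered `v` onto the centered `w`; the
    -- hypothesis makes it orthogonal to itself.
    set s := (center v ⬝ᵥ center w) / (center w ⬝ᵥ center w) with hs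
    refine ⟨s, sub_eq_zero.1 ?_⟩
    have hsum : ∑ θ, (center v - s • center w) θ = 0 := by
      simp only [Pi.sub_apply, Pi.smul_apply, smul_eq_mul, Finset.sum_sub_distrib,
        ← Finset.mul_sum, sum_center, mul_zero, sub_zero]
    have horth : (center v - s • center w) ⬝ᵥ center w = 0 := by
      rw [sub_dotProduct, smul_dotProduct, smul_eq_mul, hs, div_mul_cancel₀ _ hne, sub_self]
    have h1 : v ⬝ᵥ (center v - s • center w) = 0 := h _ hsum (by
      rw [dotProduct_comm, ← center_dotProduct w _ hsum, dotProduct_comm, horth])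
    rw [← center_dotProduct v _ hsum] at h1
    rw [← dotProduct_self_eq_zero]
    conv_lhs => enter [1]; rw [sub_eq_add_neg]
    rw [add_dotProduct, h1, neg_dotProduct, smul_dotProduct, dotProduct_comm (center w), horth]
    simp

end Center

/-! ### A necessary condition for robust incentivizability -/

section Necessity

variable {Θ A : Type*} [Fintype Θ] [Nonempty Θ] [Finite A] {u : A → Θ → ℝ} {m : ℕ}

/-- If the question for `a` is trivial then the question for an adjacent action `b` is, up to
constants, a multiple of the payoff difference. -/
theorem Incentivizable.mulVec_eq_zero {X : A → Matrix (Fin m) Θ ℝ} (hX : Incentivizable u X)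
    (hu : NonRedundant u) {a b : A} (hab : (adjacencyGraph u).Adj a b) (ha : X a = 0)
    {x : Θ → ℝ} (hx : ∑ θ, x θ = 0) (hxu : x ⬝ᵥ (u b - u a) = 0) : X b *ᵥ x = 0 := by
  obtain ⟨V, -, hV⟩ := hX
  obtain ⟨p, hp, hpos, hpab, hlt⟩ := exists_pos_belief_of_adj hu hab
  rw [dotProduct_sub, sub_eq_zero] at hxu
  have hev : ∀ y : Θ → ℝ, ∑ θ, y θ = 0 → y ⬝ᵥ u b = y ⬝ᵥ u a → ∀ᶠ ε : ℝ in nhds 0,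
      p + ε • y ∈ stdSimplex ℝ Θ ∧ IsOptimal u (p + ε • y) a ∧ IsOptimal u (p + ε • y) b := by
    intro y hy hyu
    filter_upwards [eventually_forall_pos y hpos, eventually_forall_dotProduct_lt y hlt]
      with ε h1 h2
    have h3 : (p + ε • y) ⬝ᵥ u a = (p + ε • y) ⬝ᵥ u b := by
      simp only [add_dotProduct, smul_dotProduct, hyu, hpab]
    have h4 := setOf_isOptimal_eq_pair h3 h2
    refine ⟨⟨fun θ => (h1 θ).le, ?_⟩, h4.ge (by simp), h4.ge (by simp)⟩
    simp only [Pi.add_apply, Pi.smul_apply, smul_eq_mul, Finset.sum_add_distrib, ← Finset.mul_sum,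
      hy, mul_zero, add_zero, hp.2]
  obtain ⟨ε, hε, ⟨hp1, ha1, hb1⟩, hp2, ha2, -⟩ := exists_pos_of_eventually_nhds
    ((hev x hx hxu).and (hev (-x) (by simp [hx]) (by simp [neg_dotProduct, hxu])))
  obtain ⟨-, ha0, hb0⟩ := (hev x hx hxu).self_of_nhds
  rw [zero_smul, add_zero] at ha0 hb0
  have mem : ∀ {q c}, q ∈ stdSimplex ℝ Θ → IsOptimal u q c →
      ∀ r d, q ⬝ᵥ V r d ≤ q ⬝ᵥ V (X c *ᵥ q) c := by
    intro q c hq hc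
    exact (hV q hq).ge (show (X c *ᵥ q, c) ∈ _ from ⟨rfl, hc⟩)
  have A1 := mem hp1 ha1
  have A2 := mem hp2 ha2 (X b *ᵥ p) b
  have A0 := mem hp hb0 0 a
  rw [ha, Matrix.zero_mulVec] at A1 A2
  -- The comparison at `p - ε • x` bounds the payment for `b` from above, while the one at `p`
  -- bounds it from below; affinity in the belief then gives the missing inequality at `p + ε • x`.
  have key : (p + ε • x) ⬝ᵥ V (X b *ᵥ p) b = (p + ε • x) ⬝ᵥ V 0 a := by
    refine le_antisymm (A1 _ _) ?_
    simp only [smul_neg, ← sub_eq_add_neg, sub_dotProduct, add_dotProduct] at A2 ⊢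
    linarith
  have hmem := (hV _ hp1).le (show (X b *ᵥ p, b) ∈ _ from fun r d => key ▸ A1 r d)
  have h5 : X b *ᵥ p = X b *ᵥ (p + ε • x) := hmem.1
  rw [Matrix.mulVec_add, Matrix.mulVec_smul, left_eq_add, smul_eq_zero] at h5
  exact h5.resolve_left hε.ne'

/-- The shift t = -μ(a)⁻¹X(a) makes the question at `a` zero and turns the one at `b` into μ(b)
times the difference of the normalized questions. Hence the matrices μ themselves serve as `Γ`. -/
theorem RobustlyIncentivizable.exists_sub_eq {X : A → Matrix (Fin m) Θ ℝ}
    (hX : RobustlyIncentivizable u X) (hu : NonRedundant u) :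
    ∃ Γ : A → Matrix (Fin m) (Fin m) ℝ, (∀ a, IsUnit (Γ a)) ∧
      ∀ a b, (adjacencyGraph u).Adj a b → ∃ lam : Fin m → ℝ,
        (Γ b)⁻¹ * centerRows (X b) - (Γ a)⁻¹ * centerRows (X a) =
          Matrix.vecMulVec lam (payoffDiff u a b) := by
  obtain ⟨μ, hμ, hinc⟩ := hX
  have hdet : ∀ a, IsUnit (μ a).det := fun a => (Matrix.isUnit_iff_isUnit_det _).1 (hμ a)
  refine ⟨μ, hμ, fun a b hab => ?_⟩
  have h0 : X a + μ a * -((μ a)⁻¹ * X a) = 0 := by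
    rw [Matrix.mul_neg, Matrix.mul_nonsing_inv_cancel_left _ _ (hdet a), add_neg_cancel]
  have h1 : ∀ x : Θ → ℝ, ∑ θ, x θ = 0 → x ⬝ᵥ (u b - u a) = 0 →
      ((μ b)⁻¹ * X b - (μ a)⁻¹ * X a) *ᵥ x = 0 := by
    intro x hx hxu
    have h2 := (hinc (-((μ a)⁻¹ * X a))).mulVec_eq_zero hu hab h0 hx hxu
    have h3 : (μ b)⁻¹ * X b - (μ a)⁻¹ * X a = (μ b)⁻¹ * (X b + μ b * -((μ a)⁻¹ * X a)) := by
      rw [Matrix.mul_add, Matrix.nonsing_inv_mul_cancel_left _ _ (hdet b), sub_eq_add_neg]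
    rw [h3, ← Matrix.mulVec_mulVec, h2, Matrix.mulVec_zero]
  choose s hs using fun j => exists_center_eq_smul
    (v := ((μ b)⁻¹ * X b - (μ a)⁻¹ * X a) j) (w := u b - u a) fun x hx hxu => congrFun (h1 x hx hxu) j
  refine ⟨s, ?_⟩
  rw [← centerRows_mul, ← centerRows_mul, ← centerRows_sub, payoffDiff_eq_center]
  ext j θ
  exact congrFun (hs j) θ

end Necessity

/-! ### A sufficient condition for incentivizability -/

section Sufficiency

variable {Θ A : Type*} [Fintype Θ] [Nonempty Θ] [Finite A] {u : A → Θ → ℝ} {m : ℕ}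

/-- Incentivizability is invariant under action-dependent invertible affine changes of reports. -/
theorem Incentivizable.mul_add {Y : A → Matrix (Fin m) Θ ℝ} (hY : Incentivizable u Y)
    {Γ : A → Matrix (Fin m) (Fin m) ℝ} (hΓ : ∀ a, IsUnit (Γ a)) (c : A → Fin m → ℝ) :
    Incentivizable u fun a => Γ a * Y a + Matrix.vecMulVec (c a) 1 := by
  obtain ⟨V, hV01, hV⟩ := hY
  have hdet : ∀ a, IsUnit (Γ a).det := fun a => (Matrix.isUnit_iff_isUnit_det _).1 (hΓ a)
  refine ⟨fun r a => V ((Γ a)⁻¹ *ᵥ (r - c a)) a, fun r a θ => hV01 _ _ _, fun p hp => ?_⟩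
  ext ⟨r, a⟩
  have h1 := Set.ext_iff.1 (hV p hp) ((Γ a)⁻¹ *ᵥ (r - c a), a)
  simp only [Set.mem_ofPred_eq] at h1 ⊢
  have h2 : ∀ (r : Fin m → ℝ) a, (Γ a)⁻¹ *ᵥ ((Γ a *ᵥ r + c a) - c a) = r := fun r a => by
    rw [add_sub_cancel_right, Matrix.mulVec_mulVec, Matrix.nonsing_inv_mul _ (hdet a),
      Matrix.one_mulVec]
  have h3 : (Γ a * Y a + Matrix.vecMulVec (c a) 1) *ᵥ p = Γ a *ᵥ (Y a *ᵥ p) + c a := by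
    rw [Matrix.add_mulVec, Matrix.mulVec_mulVec, Matrix.vecMulVec_mulVec, one_dotProduct, hp.2]
    simp
  rw [h3]
  constructor
  · intro h
    obtain ⟨h4, h5⟩ := h1.1 fun r' a' => by simpa only [h2] using h (Γ a' *ᵥ r' + c a') a'
    refine ⟨?_, h5⟩
    rw [← h4, Matrix.mulVec_mulVec, Matrix.mul_nonsing_inv _ (hdet a), Matrix.one_mulVec,
      sub_add_cancel]
  · rintro ⟨h4, h5⟩ r' a'
    exact h1.2 ⟨by rw [h4, h2], h5⟩ _ _

theorem exists_forall_abs_le {ι : Type*} [Finite ι] (f : ι → ℝ) : ∃ R, 0 ≤ R ∧ ∀ i, |f i| ≤ R := by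
  obtain ⟨R, hR⟩ := (Set.finite_range fun i => |f i|).bddAbove
  exact ⟨max R 0, le_max_right _ _, fun i => (hR ⟨i, rfl⟩).trans (le_max_left _ _)⟩

theorem abs_dotProduct_le_of_mem_stdSimplex {p v : Θ → ℝ} (hp : p ∈ stdSimplex ℝ Θ) {R : ℝ}
    (hv : ∀ θ, |v θ| ≤ R) : |p ⬝ᵥ v| ≤ R := by
  calc |p ⬝ᵥ v| ≤ ∑ θ, |p θ * v θ| := Finset.abs_sum_le_sum_abs _ _
    _ ≤ ∑ θ, p θ * R := Finset.sum_le_sum fun θ _ => by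
        rw [abs_mul, abs_of_nonneg (hp.1 θ)]
        exact mul_le_mul_of_nonneg_left (hv θ) (hp.1 θ)
    _ = R := by rw [← Finset.sum_mul, hp.2, one_mul]

/-- A question profile that varies along each edge of the adjacency graph by multiples of the
payoff difference is incentivized by a quadratic score plus a multiple of the payoff. -/
theorem incentivizable_of_sub_eq (hu : NonRedundant u) {Y : A → Matrix (Fin m) Θ ℝ}
    (hY : ∀ a b, (adjacencyGraph u).Adj a b → ∃ lam : Fin m → ℝ,
      Y b - Y a = Matrix.vecMulVec lam (u b - u a)) : Incentivizable u Y := by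
  classical
  rcases isEmpty_or_nonempty A with hA | hA
  · exact ⟨fun _ _ _ => 0, fun _ _ _ => by simp, fun p _ => Set.ext fun x => hA.elim x.2⟩
  choose! lam hlam using hY
  obtain ⟨L, hL, hlamL⟩ := exists_forall_abs_le fun x : A × A × Fin m => lam x.1 x.2.1 x.2.2
  obtain ⟨R, hR, hYR⟩ := exists_forall_abs_le fun x : A × Fin m × Θ => Y x.1 x.2.1 x.2.2
  obtain ⟨U, hU, huU⟩ := exists_forall_abs_le fun x : A × Θ => u x.1 x.2
  -- Each of the `m` squares can lose at most `2 * R * L` times the payoff gap in passing to an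
  -- optimal action; the extra 1 leaves a strict incentive to choose one.
  set K : ℝ := m * (2 * R * L) + 1 with hK
  have hK0 : 0 ≤ K := by positivity
  set C : ℝ := m * (3 * R ^ 2) + K * U with hC
  have hC0 : 0 ≤ C := by positivity
  let score : (Fin m → ℝ) → A → Θ → ℝ := fun r a =>
    (∑ k, ((2 * r k) • Y a k - fun _ => r k ^ 2)) + K • u a
  have hscore : ∀ r a θ, (∀ k, |r k| ≤ R) → |score r a θ| ≤ C := by
    intro r a θ hr
    have h1 : ∀ k, |2 * r k * Y a k θ - r k ^ 2| ≤ 3 * R ^ 2 := by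
      intro k
      have h2 : |r k * Y a k θ| ≤ R * R := by
        rw [abs_mul]
        exact mul_le_mul (hr k) (hYR (a, k, θ)) (abs_nonneg _) hR
      have h3 : r k ^ 2 ≤ R ^ 2 := sq_le_sq' (neg_le_of_abs_le (hr k)) (le_of_abs_le (hr k))
      rw [abs_le] at h2 ⊢
      constructor <;> nlinarith [sq_nonneg (r k)]
    have h2 : score r a θ = (∑ k, (2 * r k * Y a k θ - r k ^ 2)) + K * u a θ := by
      simp [score, Finset.sum_apply]
    rw [h2]
    refine (abs_add_le _ _).trans (add_le_add ?_ ?_)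
    · refine (Finset.abs_sum_le_sum_abs _ _).trans ?_
      refine (Finset.sum_le_sum fun k _ => h1 k).trans ?_
      simp
    · rw [abs_mul, abs_of_nonneg hK0]
      exact mul_le_mul_of_nonneg_left (huU (a, θ)) hK0
  -- Since |score| ≤ C on the box, the shift by `C + 1` rather than `C` makes truthful payments
  -- strictly positive, so reports outside the box, which are paid 0, are never optimal.
  let V : (Fin m → ℝ) → A → Θ → ℝ := fun r a θ =>
    if ∀ k, |r k| ≤ R then (score r a θ + (C + 1)) / (2 * C + 1) else 0
  have hD : 0 < 2 * C + 1 := by positivity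
  refine ⟨V, fun r a θ => ?_, fun p hp => ?_⟩
  · by_cases hr : ∀ k, |r k| ≤ R
    · have := abs_le.1 (hscore r a θ hr)
      simp only [V, if_pos hr]
      exact ⟨div_nonneg (by linarith) hD.le, (div_le_one hD).2 (by linarith)⟩
    · simp [V, if_neg hr]
  let G : A → ℝ := fun a => (∑ k, (p ⬝ᵥ Y a k) ^ 2) + K * (p ⬝ᵥ u a)
  have hconst : ∀ c : ℝ, p ⬝ᵥ (fun _ => c) = c := fun c => by
    simp [dotProduct, ← Finset.sum_mul, hp.2]
  have hpscore : ∀ r a, p ⬝ᵥ score r a = G a - ∑ k, (r k - p ⬝ᵥ Y a k) ^ 2 := by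
    intro r a
    simp only [score, G, dotProduct_add, dotProduct_sum, dotProduct_sub, dotProduct_smul, hconst,
      smul_eq_mul]
    rw [add_sub_right_comm, ← Finset.sum_sub_distrib]
    congr 1
    exact Finset.sum_congr rfl fun k _ => by ring
  have hVin : ∀ r a, (∀ k, |r k| ≤ R) → p ⬝ᵥ V r a =
      (G a - ∑ k, (r k - p ⬝ᵥ Y a k) ^ 2 + (C + 1)) / (2 * C + 1) := by
    intro r a hr
    have : V r a = (2 * C + 1)⁻¹ • (score r a + fun _ => C + 1) := by
      funext θ
      simp only [V, if_pos hr, Pi.smul_apply, Pi.add_apply, smul_eq_mul]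
      ring
    rw [this, dotProduct_smul, dotProduct_add, hconst, hpscore, smul_eq_mul, div_eq_inv_mul]
  have hVout : ∀ r a, (¬ ∀ k, |r k| ≤ R) → p ⬝ᵥ V r a = 0 := by
    intro r a hr
    have : V r a = 0 := funext fun θ => by simp [V, if_neg hr]
    rw [this, dotProduct_zero]
  have hbox : ∀ a k, |(Y a *ᵥ p) k| ≤ R := fun a k => by
    rw [Matrix.mulVec, dotProduct_comm]
    exact abs_dotProduct_le_of_mem_stdSimplex hp fun θ => hYR (a, k, θ)
  have hYp : ∀ a k, (Y a *ᵥ p) k = p ⬝ᵥ Y a k := fun a k => dotProduct_comm _ _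
  have hVtrue : ∀ a, p ⬝ᵥ V (Y a *ᵥ p) a = (G a + (C + 1)) / (2 * C + 1) := by
    intro a
    rw [hVin _ _ (hbox a)]
    simp [hYp]
  have hVpos : ∀ a, 0 < p ⬝ᵥ V (Y a *ᵥ p) a := by
    intro a
    rw [hVtrue]
    refine div_pos ?_ hD
    have h1 := abs_dotProduct_le_of_mem_stdSimplex hp fun θ => huU (a, θ)
    have h2 : 0 ≤ ∑ k, (p ⬝ᵥ Y a k) ^ 2 := Finset.sum_nonneg fun _ _ => sq_nonneg _
    have h3 : (0 : ℝ) ≤ m * (3 * R ^ 2) := by positivity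
    have h4 := mul_le_mul_of_nonneg_left (neg_le_of_abs_le h1) hK0
    simp only [G]
    linarith
  have hgap : ∀ a b, IsOptimal u p b → p ⬝ᵥ u b - p ⬝ᵥ u a ≤ G b - G a := by
    intro a b hb
    have hg : 0 ≤ p ⬝ᵥ u b - p ⬝ᵥ u a := sub_nonneg.2 (hb a)
    have h1 : ∀ k, -(2 * R * L * (p ⬝ᵥ u b - p ⬝ᵥ u a)) ≤ (p ⬝ᵥ Y b k) ^ 2 - (p ⬝ᵥ Y a k) ^ 2 := by
      intro k
      have h2 := abs_dotProduct_sub_le_of_isOptimal hu hp.1 hb (y := fun a => Y a k) (K := L)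
        (fun a c hac => ⟨lam a c k, hlamL (a, c, k), congrFun (hlam a c hac) k⟩) a
      have h3 : |p ⬝ᵥ Y b k + p ⬝ᵥ Y a k| ≤ 2 * R := by
        refine (abs_add_le _ _).trans ?_
        have := hbox a k
        have := hbox b k
        rw [hYp] at *
        linarith
      have h4 : |(p ⬝ᵥ Y b k) ^ 2 - (p ⬝ᵥ Y a k) ^ 2| ≤ 2 * R * (L * (p ⬝ᵥ u b - p ⬝ᵥ u a)) := by
        rw [sq_sub_sq, abs_mul]
        exact mul_le_mul h3 h2 (abs_nonneg _) (by positivity)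
      linarith [neg_le_of_abs_le h4]
    have h5 := Finset.sum_le_sum fun k (_ : k ∈ Finset.univ) => h1 k
    simp only [Finset.sum_const, Finset.card_univ, Fintype.card_fin, nsmul_eq_mul,
      Finset.sum_sub_distrib] at h5
    simp only [G, hK]
    linarith
  obtain ⟨b, hb⟩ : ∃ b, IsOptimal u p b := Finite.exists_max fun a => p ⬝ᵥ u a
  ext ⟨r, a⟩
  simp only [Set.mem_ofPred_eq]
  constructor
  · intro h
    have hr : ∀ k, |r k| ≤ R := by
      by_contra hr
      exact absurd (h (Y b *ᵥ p) b) (not_le.2 (by rw [hVout r a hr]; exact hVpos b))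
    have h1 := h (Y a *ᵥ p) a
    have h2 := h (Y b *ᵥ p) b
    rw [hVtrue, hVin r a hr, div_le_div_iff_of_pos_right hD] at h1 h2
    have h3 : 0 ≤ ∑ k, (r k - p ⬝ᵥ Y a k) ^ 2 := Finset.sum_nonneg fun _ _ => sq_nonneg _
    have h4 : ∑ k, (r k - p ⬝ᵥ Y a k) ^ 2 = 0 := by linarith
    refine ⟨funext fun k => ?_, fun c => (hb c).trans ?_⟩
    · have := (Finset.sum_eq_zero_iff_of_nonneg fun k _ => sq_nonneg _).1 h4 k (Finset.mem_univ k)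
      rw [hYp]
      exact sub_eq_zero.1 (pow_eq_zero_iff two_ne_zero |>.1 this)
    · linarith [hgap a b hb]
  · rintro ⟨rfl, ha⟩ r c
    by_cases hr : ∀ k, |r k| ≤ R
    · rw [hVtrue, hVin r c hr, div_le_div_iff_of_pos_right hD]
      have h3 : 0 ≤ ∑ k, (r k - p ⬝ᵥ Y c k) ^ 2 := Finset.sum_nonneg fun _ _ => sq_nonneg _
      linarith [hgap c a ha, ha c]
    · rw [hVout r c hr]
      exact (hVpos a).le

end Sufficiency

/-! ### Cochains on a graph and its cycle space -/

section Cochain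

variable {V : Type*} {G : SimpleGraph V}

theorem SimpleGraph.Walk.sum_darts_sub {E : Type*} [AddCommGroup E] (f : V → E) {a b : V}
    (p : G.Walk a b) : (p.darts.map fun δ => f δ.snd - f δ.fst).sum = f b - f a := by
  induction p with
  | nil => simp
  | cons h p ih => simp [ih]

theorem SimpleGraph.Preconnected.eq_of_forall_adj {E : Type*} (hG : G.Preconnected) {f : V → E}
    (hf : ∀ x y, G.Adj x y → f x = f y) (x y : V) : f x = f y := by
  obtain ⟨p⟩ := hG x y
  induction p with
  | nil => rfl
  | cons h p ih => exact (hf _ _ h).trans ih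

/-- The tail of an edge, for the orientation given by `edgeHead`. -/
def edgeTail (G : SimpleGraph V) (e : G.edgeSet) : V :=
  (Quot.out (e : Sym2 V)).1

theorem mk_edgeTail_edgeHead (e : G.edgeSet) : s(edgeTail G e, edgeHead G e) = e :=
  Quot.out_eq (e : Sym2 V)

theorem edgeTail_ne_edgeHead (e : G.edgeSet) : edgeTail G e ≠ edgeHead G e := by
  have h := e.2
  rw [← mk_edgeTail_edgeHead e] at h
  exact G.ne_of_adj h

open Classical in
/-- The pairing of an alternating cochain with the vector of a closed walk is the sum of the
cochain along the walk. -/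
theorem sum_cycleVector_mul [Fintype G.edgeSet] {α : V → V → ℝ}
    (hα : ∀ x y, G.Adj x y → α y x = -α x y) (c : Σ v, G.Walk v v) :
    ∑ e, cycleVector G c e * α (edgeTail G e) (edgeHead G e) =
      (c.2.darts.map fun δ => α δ.fst δ.snd).sum := by
  unfold cycleVector
  induction c.2.darts with
  | nil => simp
  | cons δ l ih =>
    simp only [List.map_cons, List.sum_cons, add_mul, Finset.sum_add_distrib, ih, add_left_inj]
    rw [Finset.sum_eq_single ⟨δ.edge, δ.edge_mem⟩ (fun e _ he => ?_) (by simp)]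
    · have h := mk_edgeTail_edgeHead (G := G) ⟨δ.edge, δ.edge_mem⟩
      have h' := edgeTail_ne_edgeHead (G := G) ⟨δ.edge, δ.edge_mem⟩
      set e : G.edgeSet := ⟨δ.edge, δ.edge_mem⟩
      have h1 : s(edgeTail G e, edgeHead G e) = s(δ.fst, δ.snd) := h
      rcases Sym2.eq_iff.1 h1 with ⟨h2, h3⟩ | ⟨h2, h3⟩
      · simp [h2, h3, e]
      · have h4 : δ.snd ≠ δ.fst := h2 ▸ h3 ▸ h'
        simp [h2, h3, h4, e, hα _ _ δ.adj]
    · rw [if_neg, zero_mul]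
      exact fun h => he (Subtype.ext h.symm)

open Classical in
theorem vertexEdgeMatrix_apply (v : V) (e : G.edgeSet) :
    vertexEdgeMatrix G v e =
      (if v = edgeHead G e then 1 else 0) - (if v = edgeTail G e then 1 else 0) := by
  have h : v ∈ (e : Sym2 V) ↔ v = edgeTail G e ∨ v = edgeHead G e := by
    rw [← mk_edgeTail_edgeHead e, Sym2.mem_iff]
  have h' := edgeTail_ne_edgeHead e
  simp only [vertexEdgeMatrix, Matrix.of_apply, h]
  by_cases h1 : v = edgeHead G e
  · simp [h1, h'.symm]
  · simp [h1]
    split_ifs <;> simp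

/-- The incidence row of a vertex is the differential of its indicator, so its pairing with a closed
walk telescopes to zero. -/
theorem cycleVector_mem_cycleSpace [Fintype V] (c : Σ v, G.Walk v v) :
    cycleVector G c ∈ cycleSpace G := by
  classical
  rw [cycleSpace, LinearMap.mem_ker]
  funext v
  rw [Matrix.mulVecLin_apply, Matrix.mulVec, dotProduct]
  simp only [vertexEdgeMatrix_apply, mul_comm _ (cycleVector G c _)]
  refine (sum_cycleVector_mul
    (α := fun x y => (if v = y then (1 : ℝ) else 0) - (if v = x then 1 else 0)) ?_ c).trans ?_
  · intro x y _
    ring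
  · rw [SimpleGraph.Walk.sum_darts_sub fun x => if v = x then (1 : ℝ) else 0, sub_self,
      Pi.zero_apply]

/-- An alternating cochain that vanishes on the cycles of a cycle basis vanishes on every closed
walk. -/
theorem IsCycleBasis.sum_darts_eq_zero [Fintype V] {B : Finset (Σ v, G.Walk v v)}
    (hB : IsCycleBasis G B) {α : V → V → ℝ} (hα : ∀ x y, G.Adj x y → α y x = -α x y)
    (h : ∀ c ∈ B, (c.2.darts.map fun δ => α δ.fst δ.snd).sum = 0) (c : Σ v, G.Walk v v) :
    (c.2.darts.map fun δ => α δ.fst δ.snd).sum = 0 := by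
  classical
  let Φ : (G.edgeSet → ℝ) →ₗ[ℝ] ℝ :=
    (dotProductBilin ℝ ℝ).flip fun e => α (edgeTail G e) (edgeHead G e)
  have hΦ : ∀ c, Φ (cycleVector G c) = (c.2.darts.map fun δ => α δ.fst δ.snd).sum :=
    fun c => sum_cycleVector_mul hα c
  have hle : cycleSpace G ≤ LinearMap.ker Φ := by
    rw [← hB.2.2, Submodule.span_le]
    rintro _ ⟨c, hc, rfl⟩
    exact (hΦ c).trans (h c hc)
  rw [← hΦ]
  exact hle (cycleVector_mem_cycleSpace c)

/-- A cochain with vanishing sums on all closed walks of a connected graph is the differential of a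
function. -/
theorem exists_potential (hG : G.Preconnected) {α : V → V → ℝ}
    (h : ∀ c : Σ v, G.Walk v v, (c.2.darts.map fun δ => α δ.fst δ.snd).sum = 0) :
    ∃ g : V → ℝ, ∀ x y, G.Adj x y → g y - g x = α x y := by
  rcases isEmpty_or_nonempty V with hV | ⟨⟨x₀⟩⟩
  · exact ⟨fun _ => 0, fun x => hV.elim x⟩
  let p : ∀ x, G.Walk x₀ x := fun x => (hG x₀ x).some
  let q : ∀ x, G.Walk x x₀ := fun x => (hG x x₀).some
  refine ⟨fun x => ((p x).darts.map fun δ => α δ.fst δ.snd).sum, fun x y hxy => ?_⟩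
  have h1 := h ⟨x₀, (p x).append (.cons hxy (q y))⟩
  have h2 := h ⟨x₀, (p y).append (q y)⟩
  simp only [SimpleGraph.Walk.darts_append, SimpleGraph.Walk.darts_cons, List.map_append,
    List.map_cons, List.sum_append, List.sum_cons] at h1 h2
  linarith

end Cochain

/-! ### Blocks -/

section Blocks

variable {V : Type*} {G : SimpleGraph V}

theorem SimpleGraph.Subgraph.Preconnected.eq_of_forall_adj {E : Type*} {H : G.Subgraph}
    (hH : H.Preconnected) {f : V → E} (hf : ∀ x y, H.Adj x y → f x = f y) {x y : V}
    (hx : x ∈ H.verts) (hy : y ∈ H.verts) : f x = f y :=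
  hH.coe.eq_of_forall_adj (f := fun x : H.verts => f x) (fun x y h => hf x y h) ⟨x, hx⟩ ⟨y, hy⟩

/-- Edge weights that are invariant along closed walks through a vertex are constant on a
block. -/
theorem IsBlock.weight_eq {H : G.Subgraph} (hH : IsBlock G H) {s : V → V → ℝ}
    (hs : ∀ x y, G.Adj x y → s y x = s x y)
    (h : ∀ (m : V → ℝ) (c : Σ v, G.Walk v v),
      (c.2.darts.map fun δ => s δ.fst δ.snd * (m δ.snd - m δ.fst)).sum = 0)
    {x y x' y' : V} (hxy : H.Adj x y) (hxy' : H.Adj x' y') : s x y = s x' y' := by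
  classical
  obtain ⟨hconn, hcut⟩ := hH.prop
  -- Go from `v` to `x`, inside the block without `v` to `y`, and back to `v`. With the indicator of
  -- `v` as `m`, only the first and last edges contribute, with opposite signs.
  have local_eq : ∀ {v x y}, H.Adj v x → H.Adj v y → s v x = s v y := by
    intro v x y hvx hvy
    have hx : x ∈ (H.deleteVerts {v}).verts := ⟨hvx.snd_mem, hvx.adj_sub.ne'⟩
    have hy : y ∈ (H.deleteVerts {v}).verts := ⟨hvy.snd_mem, hvy.adj_sub.ne'⟩
    obtain ⟨p⟩ := (hcut v hvx.fst_mem).coe ⟨x, hx⟩ ⟨y, hy⟩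
    have key : ∀ {a b : (H.deleteVerts {v}).verts} (p : (H.deleteVerts {v}).coe.Walk a b),
        ((p.map (H.deleteVerts {v}).hom).darts.map fun δ => s δ.fst δ.snd *
          ((if δ.snd = v then (1 : ℝ) else 0) - (if δ.fst = v then 1 else 0))).sum = 0 := by
      intro a b p
      induction p with
      | nil => simp
      | @cons a b c hab p ih =>
        have ha : (a : V) ≠ v := a.2.2
        have hb : (b : V) ≠ v := b.2.2
        simp only [SimpleGraph.Walk.map_cons, SimpleGraph.Walk.darts_cons, List.map_cons,
          List.sum_cons, ih]
        simp [ha, hb]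
    obtain ⟨q, hq⟩ : ∃ q : G.Walk x y, (q.darts.map fun δ => s δ.fst δ.snd *
        ((if δ.snd = v then (1 : ℝ) else 0) - (if δ.fst = v then 1 else 0))).sum = 0 :=
      ⟨p.map (H.deleteVerts {v}).hom, key p⟩
    have h1 := h (fun w => if w = v then 1 else 0) ⟨v, .cons hvx.adj_sub
      (q.append (.cons hvy.adj_sub.symm .nil))⟩
    simp only [SimpleGraph.Walk.darts_cons, SimpleGraph.Walk.darts_append, List.map_cons,
      List.map_append, List.sum_cons, List.sum_append, hq, SimpleGraph.Walk.darts_nil,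
      List.map_nil, List.sum_nil] at h1
    simp [hvx.adj_sub.ne', hvy.adj_sub.ne', hs _ _ hvy.adj_sub] at h1
    linarith
  -- "All block edges at this vertex have weight `s x y`" passes to neighbours, so it propagates
  -- through the connected block.
  have hQ : (∀ z, H.Adj x z → s x z = s x y) = (∀ z, H.Adj x' z → s x' z = s x y) := by
    refine hconn.preconnected.eq_of_forall_adj (f := fun w => ∀ z, H.Adj w z → s w z = s x y) ?_
      hxy.fst_mem hxy'.fst_mem
    intro w w' hw
    refine propext ⟨fun hz z hwz => ?_, fun hz z hwz => ?_⟩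
    · rw [local_eq hwz hw.symm, hs _ _ hw.adj_sub, hz _ hw]
    · rw [local_eq hwz hw, ← hs _ _ hw.adj_sub, hz _ hw.symm]
  exact (hQ.mp (fun z hz => local_eq hz hxy) y' hxy').symm

/-- A single edge is connected without cut-vertices, since removing an endpoint leaves one vertex;
finiteness extends it to a maximal such subgraph. -/
theorem exists_block_of_adj [Finite V] {x y : V} (h : G.Adj x y) :
    ∃ z : Block G, x ∈ z.1.verts ∧ y ∈ z.1.verts := by
  have hP : (G.subgraphOfAdj h).Connected ∧ ∀ v ∈ (G.subgraphOfAdj h).verts,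
      ((G.subgraphOfAdj h).deleteVerts {v}).Preconnected := by
    refine ⟨SimpleGraph.Subgraph.subgraphOfAdj_connected h, fun v hv => ⟨?_⟩⟩
    have : Subsingleton ((G.subgraphOfAdj h).deleteVerts {v}).verts := by
      refine ⟨fun ⟨a, ha, ha'⟩ ⟨b, hb, hb'⟩ => Subtype.ext ?_⟩
      have hv' : v = x ∨ v = y := hv
      have ha1 : a = x ∨ a = y := ha
      have hb1 : b = x ∨ b = y := hb
      have ha2 : a ≠ v := ha'
      have hb2 : b ≠ v := hb'
      grind
    exact SimpleGraph.Preconnected.of_subsingleton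
  obtain ⟨K, hle, hK⟩ := Finite.exists_le_maximal
    (p := fun K : G.Subgraph => K.Connected ∧ ∀ v ∈ K.verts, (K.deleteVerts {v}).Preconnected) hP
  exact ⟨⟨K, hK⟩, hle.1 (by simp), hle.1 (by simp)⟩

theorem exists_block_of_vertex [Finite V] (x : V) : ∃ z : Block G, x ∈ z.1.verts := by
  have hP : (G.singletonSubgraph x).Connected ∧ ∀ v ∈ (G.singletonSubgraph x).verts,
      ((G.singletonSubgraph x).deleteVerts {v}).Preconnected := by
    refine ⟨SimpleGraph.Subgraph.singletonSubgraph_connected, fun v hv => ⟨?_⟩⟩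
    have : Subsingleton ((G.singletonSubgraph x).deleteVerts {v}).verts := by
      refine ⟨fun ⟨a, ha, ha'⟩ ⟨b, hb, hb'⟩ => Subtype.ext ?_⟩
      have ha1 : a = x := ha
      have hb1 : b = x := hb
      exact ha1.trans hb1.symm
    exact SimpleGraph.Preconnected.of_subsingleton
  obtain ⟨K, hle, hK⟩ := Finite.exists_le_maximal
    (p := fun K : G.Subgraph => K.Connected ∧ ∀ v ∈ K.verts, (K.deleteVerts {v}).Preconnected) hP
  exact ⟨⟨K, hK⟩, hle.1 (by simp)⟩

end Blocks

/-! ### Cycle independence -/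

section CycleIndependence

theorem List.sum_apply_get {α M : Type*} [AddCommMonoid M] (l : List α) (g : α → M) :
    ∑ k, g (l.get k) = (l.map g).sum := by
  rw [← List.sum_ofFn]
  change (List.ofFn (g ∘ l.get)).sum = _
  rw [← List.map_ofFn, List.ofFn_get]

/-- If `n` vectors of rank `n - 1` sum to zero, then all their linear relations have equal
coefficients. -/
theorem coeff_eq_of_sum_smul_eq_zero {ι E : Type*} [Fintype ι] [AddCommGroup E] [Module ℝ E]
    {f : ι → E} (hf : Set.finrank ℝ (Set.range f) + 1 = Fintype.card ι) (hsum : ∑ i, f i = 0)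
    {w : ι → ℝ} (hw : ∑ i, w i • f i = 0) (i j : ι) : w i = w j := by
  -- By rank-nullity the space of linear relations is a line, and it contains the all-ones vector.
  let T := Fintype.linearCombination ℝ f
  have h1 := T.finrank_range_add_finrank_ker
  rw [Fintype.range_linearCombination, Module.finrank_fintype_fun_eq_card, ← hf] at h1
  have h2 : Module.finrank ℝ (LinearMap.ker T) = 1 := Nat.add_left_cancel h1
  have hone : (1 : ι → ℝ) ∈ LinearMap.ker T := by
    simp [T, Fintype.linearCombination_apply, hsum]
  have hne : (⟨1, hone⟩ : LinearMap.ker T) ≠ 0 := by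
    intro h
    have := congrFun (congrArg Subtype.val h) i
    simp at this
  obtain ⟨c, hc⟩ := (finrank_eq_one_iff_of_nonzero' _ hne).1 h2
    ⟨w, by simpa [T, Fintype.linearCombination_apply] using hw⟩
  have hcw : c • (1 : ι → ℝ) = w := congrArg Subtype.val hc
  rw [← hcw]
  simp

variable {Θ A : Type*} [Fintype Θ] {u : A → Θ → ℝ}

theorem payoffDiff_ne_zero (hu : NonRedundant u) {a b : A} (hab : a ≠ b) :
    payoffDiff u a b ≠ 0 := by
  intro h
  obtain ⟨c, hc⟩ := eq_const_of_center_eq_zero ((payoffDiff_eq_center u a b).symm.trans h)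
  have hp : ∀ p ∈ stdSimplex ℝ Θ, p ⬝ᵥ (u b - u a) = c := by
    intro p hp
    rw [hc]
    simp [dotProduct, ← Finset.sum_mul, hp.2]
  obtain ⟨p, hp1, hpa⟩ := hu a
  obtain ⟨q, hq1, hqb⟩ := hu b
  have h1 := dotProduct_lt_of_forall_ne hpa hab
  have h2 := dotProduct_lt_of_forall_ne hqb hab.symm
  rw [hp q hq1] at h2
  rw [← neg_sub, dotProduct_neg, hp p hp1] at h1
  linarith

/-- If a function of the action varies along each edge by a multiple of an injective image of the
payoff difference, then the weighted variations of any real function vanish on closed walks. -/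
theorem CycleIndependence.sum_darts_eq_zero [Fintype A] (hc : CycleIndependence u)
    {E : Type*} [AddCommGroup E] [Module ℝ E] {φ : (Θ → ℝ) →ₗ[ℝ] E}
    (hφ : ∀ v, φ (center v) = 0 → center v = 0) {f : A → E} {s : A → A → ℝ}
    (hs : ∀ x y, (adjacencyGraph u).Adj x y → s y x = s x y)
    (hf : ∀ x y, (adjacencyGraph u).Adj x y → f y - f x = s x y • φ (payoffDiff u x y))
    (m : A → ℝ) (c : Σ v, (adjacencyGraph u).Walk v v) :
    (c.2.darts.map fun δ => s δ.fst δ.snd * (m δ.snd - m δ.fst)).sum = 0 := by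
  obtain ⟨B, ⟨hB, -⟩, hrank⟩ := hc
  refine hB.sum_darts_eq_zero (α := fun x y => s x y * (m y - m x)) (fun x y h => ?_)
    (fun c hc => ?_) c
  · rw [hs x y h]
    ring
  let D := c.2.darts
  let F : Fin D.length → Θ → ℝ := fun k => payoffDiff u (D.get k).fst (D.get k).snd
  have hrange : Set.range F = {w | ∃ δ ∈ c.2.darts, w = payoffDiff u δ.fst δ.snd} := by
    ext w
    constructor
    · rintro ⟨k, rfl⟩
      exact ⟨_, List.get_mem D k, rfl⟩
    · rintro ⟨δ, hδ, rfl⟩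
      obtain ⟨k, hk⟩ := List.mem_iff_get.1 hδ
      exact ⟨k, by simp only [F, D, hk]⟩
  have h1 : Set.finrank ℝ (Set.range F) + 1 = Fintype.card (Fin D.length) := by
    rw [hrange, hrank c hc, Fintype.card_fin, SimpleGraph.Walk.length_darts]
  have h2 : ∑ k, F k = 0 := by
    refine (D.sum_apply_get fun δ => payoffDiff u δ.fst δ.snd).trans ?_
    simp only [payoffDiff]
    rw [SimpleGraph.Walk.sum_darts_sub (fun a => center (u a)), sub_self]
  -- The image under `φ` telescopes to the total variation of `f` around the cycle, which is zero;
  -- injectivity of `φ` on centered vectors brings the relation back.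
  have h3 : ∑ k, s (D.get k).fst (D.get k).snd • F k = 0 := by
    have h4 : φ (center (∑ k, s (D.get k).fst (D.get k).snd • (u (D.get k).snd - u (D.get k).fst)))
        = 0 := by
      rw [center_sum, map_sum]
      have h6 : ∀ k, φ (center (s (D.get k).fst (D.get k).snd •
          (u (D.get k).snd - u (D.get k).fst))) = f (D.get k).snd - f (D.get k).fst := by
        intro k
        rw [center_smul, map_smul, ← payoffDiff_eq_center, hf _ _ (D.get k).adj]
      simp only [h6]
      refine (D.sum_apply_get fun δ => f δ.snd - f δ.fst).trans ?_
      rw [SimpleGraph.Walk.sum_darts_sub f, sub_self]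
    have h5 := hφ _ h4
    simpa only [center_sum, center_smul, ← payoffDiff_eq_center] using h5
  have h4 := coeff_eq_of_sum_smul_eq_zero h1 h2 h3
  have h5 : ∀ δ ∈ D, ∀ δ' ∈ D, s δ.fst δ.snd = s δ'.fst δ'.snd := by
    intro δ hδ δ' hδ'
    obtain ⟨k, rfl⟩ := List.mem_iff_get.1 hδ
    obtain ⟨l, rfl⟩ := List.mem_iff_get.1 hδ'
    exact h4 k l
  rcases hD : D with _ | ⟨δ₀, l⟩
  · have : c.2.darts = [] := hD
    simp [this]
  · have h6 : c.2.darts.map (fun δ => s δ.fst δ.snd * (m δ.snd - m δ.fst)) =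
        c.2.darts.map fun δ => s δ₀.fst δ₀.snd * (m δ.snd - m δ.fst) :=
      List.map_congr_left fun δ hδ => by
        rw [h5 δ hδ δ₀ (hD ▸ List.mem_cons_self)]
    rw [h6, List.sum_map_mul_left, SimpleGraph.Walk.sum_darts_sub m, sub_self, mul_zero]

end CycleIndependence

/-! ### Consequences of cycle independence for a single task -/

section SingleTask

variable {Θ A : Type*} [Fintype Θ] {u : A → Θ → ℝ}
  {E : Type*} [AddCommGroup E] [Module ℝ E] {φ : (Θ → ℝ) →ₗ[ℝ] E} {f : A → E}

theorem payoffDiff_comm (a b : A) : payoffDiff u b a = -payoffDiff u a b :=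
  (neg_sub _ _).symm

/-- Reversing an edge negates both sides, and the payoff difference has nonzero image, so the
coefficient is unique. This makes coefficients chosen separately for the two directions agree. -/
theorem coeff_symm (hu : NonRedundant u) (hφ : ∀ v, φ (center v) = 0 → center v = 0)
    {s : A → A → ℝ}
    (hf : ∀ x y, (adjacencyGraph u).Adj x y → f y - f x = s x y • φ (payoffDiff u x y))
    (x y : A) (hxy : (adjacencyGraph u).Adj x y) : s y x = s x y := by
  have h1 := hf x y hxy
  have h2 := hf y x hxy.symm
  rw [payoffDiff_comm, map_neg, smul_neg, ← neg_sub, h1, neg_inj] at h2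
  by_contra hne
  have h3 : (s x y - s y x) • φ (payoffDiff u x y) = 0 := by rw [sub_smul, h2, sub_self]
  rw [smul_eq_zero, sub_eq_zero] at h3
  have h4 := h3.resolve_left (Ne.symm hne)
  rw [payoffDiff_eq_center] at h4
  exact payoffDiff_ne_zero hu hxy.ne ((payoffDiff_eq_center _ _ _).trans (hφ _ h4))

/-- On a block, a function that varies along edges by multiples of the payoff difference is an
affine image of the payoff. -/
theorem CycleIndependence.exists_affine_on_block [Fintype A] (hc : CycleIndependence u) (hu : NonRedundant u)
    (hφ : ∀ v, φ (center v) = 0 → center v = 0)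
    (hf : ∀ x y, (adjacencyGraph u).Adj x y → ∃ s : ℝ, f y - f x = s • φ (payoffDiff u x y))
    (z : Block (adjacencyGraph u)) :
    ∃ (σ : ℝ) (d : E), ∀ x ∈ z.1.verts, f x = σ • φ (center (u x)) + d := by
  choose! s hs using hf
  have hsymm := coeff_symm hu hφ hs
  obtain ⟨σ, hσ⟩ : ∃ σ, ∀ x y, z.1.Adj x y → s x y = σ := by
    by_cases h : ∃ x y, z.1.Adj x y
    · obtain ⟨x, y, hxy⟩ := h
      exact ⟨s x y, fun x' y' h' => z.2.weight_eq hsymm (hc.sum_darts_eq_zero hφ hsymm hs) h' hxy⟩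
    -- A block without edges imposes no condition on the slope.
    · exact ⟨0, fun x y hxy => absurd ⟨x, y, hxy⟩ h⟩
  obtain ⟨x₀, hx₀⟩ := z.2.prop.1.nonempty
  refine ⟨σ, f x₀ - σ • φ (center (u x₀)), fun x hx => ?_⟩
  have := z.2.prop.1.preconnected.eq_of_forall_adj (f := fun x => f x - σ • φ (center (u x)))
    (fun x y hxy => ?_) hx hx₀
  · rw [← this]
    abel
  · have h1 := hs x y hxy.adj_sub
    rw [hσ x y hxy, payoffDiff, map_sub, smul_sub] at h1
    rw [sub_eq_sub_iff_sub_eq_sub, ← neg_sub, h1]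
    abel

/-- The coefficients of a function that varies along edges by multiples of the payoff difference
integrate any real function of the action. -/
theorem CycleIndependence.exists_weighted_potential [Fintype A] [Nonempty Θ]
    (hc : CycleIndependence u)
    (hu : NonRedundant u) (hφ : ∀ v, φ (center v) = 0 → center v = 0)
    (hf : ∀ x y, (adjacencyGraph u).Adj x y → ∃ s : ℝ, f y - f x = s • φ (payoffDiff u x y))
    (m : A → ℝ) :
    ∃ g : A → ℝ, ∀ x y, (adjacencyGraph u).Adj x y → ∃ s : ℝ,
      f y - f x = s • φ (payoffDiff u x y) ∧ g y - g x = s * (m y - m x) := by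
  choose! s hs using hf
  obtain ⟨g, hg⟩ := exists_potential (α := fun x y => s x y * (m y - m x)) (adjacencyGraph_preconnected hu)
    (hc.sum_darts_eq_zero hφ (coeff_symm hu hφ hs) hs m)
  exact ⟨g, fun x y hxy => ⟨s x y, hs x y hxy, hg x y hxy⟩⟩

end SingleTask

/-! ### Additive separability -/

section Separability

theorem sub_eq_sub_of_forall_adj {V W E : Type*} [AddCommGroup E] {G : SimpleGraph V}
    {H : SimpleGraph W} (hG : G.Preconnected) (hH : H.Preconnected) {F : V → W → E}
    (hF : ∀ x x' y y', G.Adj x x' → H.Adj y y' → F x' y' - F x y' = F x' y - F x y)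
    (x x' : V) (y y' : W) : F x' y' - F x y' = F x' y - F x y := by
  have h1 : ∀ x x', G.Adj x x' → ∀ y y', F x' y' - F x y' = F x' y - F x y := fun x x' hx y y' =>
    hH.eq_of_forall_adj (f := fun y => F x' y - F x y) (fun y' y hy => hF x x' y y' hx hy.symm) y' y
  have h2 := hG.eq_of_forall_adj (f := fun x => F x y' - F x y) (fun x x' hx => by
    have := h1 x x' hx y y'
    rw [sub_eq_sub_iff_add_eq_add] at this ⊢
    rw [add_comm, ← this, add_comm]) x' x
  rw [sub_eq_sub_iff_add_eq_add] at h2 ⊢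
  rw [h2, add_comm]

variable {ι : Type*} [Fintype ι] [DecidableEq ι] {A : ι → Type*} {E : Type*} [AddCommGroup E]

/-- A function on a product whose mixed second differences vanish is additively separable. -/
theorem sub_eq_sum_of_mixed_differences {Y : (∀ i, A i) → E}
    (hY : ∀ (a : ∀ i, A i) (i j : ι), i ≠ j → ∀ (x : A i) (y : A j),
      Y (Function.update (Function.update a i x) j y) - Y (Function.update a j y) =
        Y (Function.update a i x) - Y a) (a₀ a : ∀ i, A i) :
    Y a - Y a₀ = ∑ i, (Y (Function.update a₀ i (a i)) - Y a₀) := by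
  -- Coordinates are switched from `a₀` to `a` one at a time; the effect of the next switch does not
  -- depend on those already made.
  have h1 : ∀ (s : Finset ι) (i : ι), i ∉ s → ∀ x : A i,
      Y (Function.update (s.piecewise a a₀) i x) - Y (s.piecewise a a₀) =
        Y (Function.update a₀ i x) - Y a₀ := by
    intro s
    induction s using Finset.induction_on with
    | empty => simp
    | insert j s hj ih =>
      intro i hi x
      rw [Finset.mem_insert, not_or] at hi
      have h2 := hY (s.piecewise a a₀) j i (Ne.symm hi.1) (a j) x
      rw [Finset.piecewise_insert, ← ih i hi.2 x]
      rw [sub_eq_sub_iff_add_eq_add] at h2 ⊢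
      rw [h2, add_comm]
  have h2 : ∀ s : Finset ι, Y (s.piecewise a a₀) - Y a₀ =
      ∑ i ∈ s, (Y (Function.update a₀ i (a i)) - Y a₀) := by
    intro s
    induction s using Finset.induction_on with
    | empty => simp
    | insert j s hj ih =>
      rw [Finset.sum_insert hj, ← ih, ← h1 s j hj, Finset.piecewise_insert]
      abel
  simpa using h2 Finset.univ

end Separability

/-! ### Product problems -/

section Product

variable {ι : Type*} [Fintype ι] [DecidableEq ι] {Θ A : ι → Type*} [∀ i, Fintype (Θ i)]
  {u : ∀ i, A i → Θ i → ℝ}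

/-- A vector on the states of one task, as a vector on the states of the product problem. -/
def liftTask (Θ : ι → Type*) (i : ι) : (Θ i → ℝ) →ₗ[ℝ] (∀ i, Θ i) → ℝ :=
  LinearMap.funLeft ℝ ℝ fun θ => θ i

theorem liftTask_apply (i : ι) (v : Θ i → ℝ) (θ : ∀ i, Θ i) : liftTask Θ i v θ = v (θ i) := rfl

theorem exists_marginal {p : (∀ i, Θ i) → ℝ} (hp : p ∈ stdSimplex ℝ (∀ i, Θ i)) (i : ι) :
    ∃ q ∈ stdSimplex ℝ (Θ i), ∀ v, p ⬝ᵥ liftTask Θ i v = q ⬝ᵥ v := by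
  classical
  let q : Θ i → ℝ := fun x => ∑ θ, if θ i = x then p θ else 0
  have hq : ∀ v, p ⬝ᵥ liftTask Θ i v = q ⬝ᵥ v := by
    intro v
    simp only [dotProduct, q, Finset.sum_mul]
    rw [Finset.sum_comm]
    refine Finset.sum_congr rfl fun θ _ => ?_
    simp [liftTask_apply]
  refine ⟨q, ⟨fun x => Finset.sum_nonneg fun θ _ => ?_, ?_⟩, hq⟩
  · split_ifs
    exacts [hp.1 θ, le_rfl]
  · have := hq fun _ => 1
    simp only [dotProduct, liftTask_apply, mul_one, hp.2] at this
    exact this.symm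

/-- The independent product of the beliefs has them as marginals. As payoffs are additive across
tasks, optimality in the product depends only on marginals. -/
theorem exists_product_belief {q : ∀ i, Θ i → ℝ} (hq : ∀ i, q i ∈ stdSimplex ℝ (Θ i)) :
    ∃ p ∈ stdSimplex ℝ (∀ i, Θ i), ∀ i v, p ⬝ᵥ liftTask Θ i v = q i ⬝ᵥ v := by
  refine ⟨fun θ => ∏ i, q i (θ i), ⟨fun θ => Finset.prod_nonneg fun i _ => (hq i).1 _, ?_⟩,
    fun i v => ?_⟩
  · have := Finset.prod_univ_sum (fun i => (Finset.univ : Finset (Θ i))) q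
    rw [Fintype.piFinset_univ] at this
    rw [← this]
    exact Finset.prod_eq_one fun i _ => (hq i).2
  · have := Finset.prod_univ_sum (fun i => (Finset.univ : Finset (Θ i)))
      (Function.update q i (q i * v))
    rw [Fintype.piFinset_univ] at this
    have h1 : ∀ θ : ∀ i, Θ i, ∏ j, Function.update q i (q i * v) j (θ j) =
        (∏ j, q j (θ j)) * v (θ i) := by
      intro θ
      rw [← Finset.mul_prod_erase _ _ (Finset.mem_univ i),
        ← Finset.mul_prod_erase _ (fun j => q j (θ j)) (Finset.mem_univ i),
        Function.update_self, Pi.mul_apply, mul_right_comm]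
      congr 1
      congr 1
      exact Finset.prod_congr rfl fun j hj => by
        rw [Function.update_of_ne (Finset.ne_of_mem_erase hj)]
    simp only [h1] at this
    simp only [dotProduct, liftTask_apply]
    rw [← this, ← Finset.mul_prod_erase _ _ (Finset.mem_univ i), Function.update_self,
      Finset.prod_eq_one, mul_one]
    · rfl
    · intro j hj
      rw [Function.update_of_ne (Finset.ne_of_mem_erase hj)]
      exact (hq j).2

theorem totalPayoff_eq_sum (a : ∀ i, A i) : totalPayoff u a = ∑ i, liftTask Θ i (u i (a i)) := by
  funext θ
  simp [totalPayoff, liftTask_apply]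

theorem sum_update_sub {E : Type*} [AddCommGroup E] (f : ∀ i, A i → E) (a : ∀ i, A i) (i : ι)
    (y : A i) : ∑ j, f j (Function.update a i y j) - ∑ j, f j (a j) = f i y - f i (a i) := by
  rw [← Finset.sum_sub_distrib, Finset.sum_eq_single i, Function.update_self]
  · intro j _ hj
    rw [Function.update_of_ne hj, sub_self]
  · simp

theorem totalPayoff_update_sub (a : ∀ i, A i) (i : ι) (y : A i) :
    totalPayoff u (Function.update a i y) - totalPayoff u a =
      liftTask Θ i (u i y - u i (a i)) := by
  rw [totalPayoff_eq_sum, totalPayoff_eq_sum, map_sub]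
  exact sum_update_sub (fun i x => liftTask Θ i (u i x)) a i y

section Marginals

variable {p : (∀ i, Θ i) → ℝ} {q : ∀ i, Θ i → ℝ}

theorem dotProduct_totalPayoff (h : ∀ i v, p ⬝ᵥ liftTask Θ i v = q i ⬝ᵥ v) (a : ∀ i, A i) :
    p ⬝ᵥ totalPayoff u a = ∑ i, q i ⬝ᵥ u i (a i) := by
  rw [totalPayoff_eq_sum, dotProduct_sum]
  exact Finset.sum_congr rfl fun i _ => h i _

theorem isOptimal_totalPayoff_iff (h : ∀ i v, p ⬝ᵥ liftTask Θ i v = q i ⬝ᵥ v) (a : ∀ i, A i) :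
    IsOptimal (totalPayoff u) p a ↔ ∀ i, IsOptimal (u i) (q i) (a i) := by
  constructor
  · intro ha i y
    have h1 := ha (Function.update a i y)
    have h2 := congrArg (p ⬝ᵥ ·) (totalPayoff_update_sub (u := u) a i y)
    simp only [dotProduct_sub, h] at h2
    linarith
  · intro ha b
    rw [dotProduct_totalPayoff h, dotProduct_totalPayoff h]
    exact Finset.sum_le_sum fun i _ => ha i (b i)

end Marginals

theorem nonRedundant_totalPayoff (hu : ∀ i, NonRedundant (u i)) :
    NonRedundant (totalPayoff u) := by
  intro a
  choose q hq hqa using fun i => hu i (a i)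
  obtain ⟨p, hp, hpq⟩ := exists_product_belief hq
  refine ⟨p, hp, fun b hb => ?_⟩
  rw [dotProduct_totalPayoff hpq, dotProduct_totalPayoff hpq]
  obtain ⟨i, hi⟩ := Function.ne_iff.1 hb
  refine Finset.sum_lt_sum (fun j _ => ?_) ⟨i, Finset.mem_univ i, hqa i _ hi⟩
  by_cases hj : b j = a j
  · rw [hj]
  · exact (hqa j _ hj).le

/-- The adjacency graph of the product problem is the Cartesian product of the adjacency graphs of
the tasks. -/
theorem adjacencyGraph_totalPayoff_adj_iff (hu : ∀ i, NonRedundant (u i)) {a b : ∀ i, A i} :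
    (adjacencyGraph (totalPayoff u)).Adj a b ↔
      ∃ i y, (adjacencyGraph (u i)).Adj (a i) y ∧ b = Function.update a i y := by
  constructor
  · rintro ⟨hab, p, hp, hopt⟩
    choose q hq hpq using exists_marginal hp
    have hiff : ∀ c, (∀ i, IsOptimal (u i) (q i) (c i)) ↔ c = a ∨ c = b := fun c =>
      (isOptimal_totalPayoff_iff hpq c).symm.trans (Set.ext_iff.1 hopt c)
    have ha := (hiff a).2 (Or.inl rfl)
    have hb := (hiff b).2 (Or.inr rfl)
    obtain ⟨i, hi⟩ := Function.ne_iff.1 hab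
    have hupd : ∀ x, IsOptimal (u i) (q i) x →
        ∀ j, IsOptimal (u j) (q j) (Function.update a i x j) := by
      intro x hx j
      by_cases hj : j = i
      · subst hj
        rwa [Function.update_self]
      · rw [Function.update_of_ne hj]
        exact ha j
    -- Optimality is coordinatewise, so `a` with its `i`-th entry taken from `b` is also optimal. It
    -- differs from `a`, hence equals `b`.
    have hb' : b = Function.update a i (b i) := by
      rcases (hiff _).1 (hupd _ (hb i)) with h | h
      · exact absurd (by simpa using (congrFun h i).symm) hi
      · exact h.symm
    refine ⟨i, b i, ⟨hi, q i, hq i, ?_⟩, hb'⟩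
    ext x
    constructor
    · intro hx
      rcases (hiff _).1 (hupd x hx) with h | h
      · exact Or.inl (by simpa using congrFun h i)
      · exact Or.inr (by simpa using congrFun h i)
    · rintro (rfl | rfl)
      exacts [ha i, hb i]
  · rintro ⟨i, y, ⟨hne, r, hr, hopt⟩, rfl⟩
    choose q hq hqa using fun j => hu j (a j)
    obtain ⟨p, hp, hpq⟩ := exists_product_belief (q := Function.update q i r) fun j => by
      by_cases hj : j = i
      · subst hj
        rwa [Function.update_self]
      · rw [Function.update_of_ne hj]
        exact hq j
    refine ⟨fun h => hne (by simpa using congrFun h i), p, hp, ?_⟩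
    have hi : ∀ x, IsOptimal (u i) (Function.update q i r i) x ↔ x = a i ∨ x = y := fun x => by
      rw [Function.update_self]
      exact Set.ext_iff.1 hopt x
    have hj : ∀ j, j ≠ i → ∀ x, IsOptimal (u j) (Function.update q i r j) x ↔ x = a j := by
      intro j hj x
      rw [Function.update_of_ne hj]
      constructor
      · intro hx
        by_contra hne
        exact absurd (hx (a j)) (not_le.2 (hqa j x hne))
      · rintro rfl c
        by_cases hc : c = a j
        · rw [hc]
        · exact (hqa j c hc).le
    ext c
    simp only [Set.mem_ofPred_eq, isOptimal_totalPayoff_iff hpq, Set.mem_insert_iff,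
      Set.mem_singleton_iff]
    constructor
    · intro hc
      rcases (hi _).1 (hc i) with h | h
      · left
        funext j
        by_cases hji : j = i
        · subst hji
          exact h
        · exact (hj j hji _).1 (hc j)
      · right
        funext j
        by_cases hji : j = i
        · subst hji
          rw [Function.update_self, h]
        · rw [Function.update_of_ne hji]
          exact (hj j hji _).1 (hc j)
    · rintro (rfl | rfl) j
      · by_cases hji : j = i
        · subst hji
          exact (hi _).2 (Or.inl rfl)
        · exact (hj j hji _).2 rfl
      · by_cases hji : j = i
        · subst hji
          exact (hi _).2 (Or.inr (by rw [Function.update_self]))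
        · exact (hj j hji _).2 (by rw [Function.update_of_ne hji])

variable [∀ i, Nonempty (Θ i)]

/-- Lifting a vector to the product problem and centering it there. -/
def centerLift (Θ : ι → Type*) [∀ i, Fintype (Θ i)] (i : ι) :
    (Θ i → ℝ) →ₗ[ℝ] (∀ i, Θ i) → ℝ :=
  centerLinearMap (∀ i, Θ i) ∘ₗ liftTask Θ i

theorem centerLift_apply (i : ι) (v : Θ i → ℝ) : centerLift Θ i v = center (liftTask Θ i v) := rfl

theorem centerLift_center (i : ι) (v : Θ i → ℝ) : centerLift Θ i (center v) = centerLift Θ i v := by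
  have h : liftTask Θ i (center v) = liftTask Θ i v -
      fun _ => (∑ x, v x) / (Fintype.card (Θ i) : ℝ) := rfl
  rw [centerLift_apply, h, center_sub, center_const, sub_zero, centerLift_apply]

theorem center_eq_zero_of_centerLift_eq_zero (i : ι) {v : Θ i → ℝ} (h : centerLift Θ i v = 0) :
    center v = 0 := by
  obtain ⟨c, hc⟩ := eq_const_of_center_eq_zero h
  have : v = fun _ => c := by
    funext x
    have h1 := congrFun hc (Function.update (fun i => Classical.arbitrary (Θ i)) i x)
    rwa [liftTask_apply, Function.update_self] at h1
  rw [this, center_const]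

theorem centerLift_injective (i : ι) (v : Θ i → ℝ) (h : centerLift Θ i (center v) = 0) :
    center v = 0 := by
  rw [centerLift_center] at h
  exact center_eq_zero_of_centerLift_eq_zero i h

/-- Centered lifts from different tasks are linearly independent. -/
theorem centerLift_eq_zero_of_eq {i j : ι} (hij : i ≠ j) {v : Θ i → ℝ} {w : Θ j → ℝ}
    (h : centerLift Θ i v = centerLift Θ j w) : centerLift Θ i v = 0 := by
  rw [centerLift_apply, centerLift_apply, ← sub_eq_zero, ← center_sub] at h
  obtain ⟨c, hc⟩ := eq_const_of_center_eq_zero h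
  let θ : ∀ i, Θ i := fun i => Classical.arbitrary (Θ i)
  -- Varying only coordinate `i` leaves the vector lifted from task `j` fixed, so `v` is constant.
  have : v = fun _ => c + w (θ j) := by
    funext x
    have h1 := congrFun hc (Function.update θ i x)
    rw [Pi.sub_apply, liftTask_apply, liftTask_apply, Function.update_self,
      Function.update_of_ne hij.symm] at h1
    linarith
  rw [← centerLift_center, this, center_const, map_zero]

theorem payoffDiff_totalPayoff_update (a : ∀ i, A i) (i : ι) (y : A i) :
    payoffDiff (totalPayoff u) a (Function.update a i y) =
      centerLift Θ i (payoffDiff (u i) (a i) y) := by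
  rw [payoffDiff_eq_center, totalPayoff_update_sub, payoffDiff_eq_center, centerLift_center,
    centerLift_apply]

/-- If a profile of matrices varies along the edges of the product graph by multiples of the payoff
differences, then it is additively separable. -/
theorem sub_eq_sum_of_forall_adj [∀ i, Finite (A i)] (hu : ∀ i, NonRedundant (u i)) {m : ℕ}
    {Z : (∀ i, A i) → Matrix (Fin m) (∀ i, Θ i) ℝ}
    (hZ : ∀ (a : ∀ i, A i) (i : ι) (y : A i), (adjacencyGraph (u i)).Adj (a i) y →
      ∃ lam : Fin m → ℝ, Z (Function.update a i y) - Z a =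
        Matrix.vecMulVec lam (centerLift Θ i (payoffDiff (u i) (a i) y))) (a₀ a : ∀ i, A i) :
    Z a - Z a₀ = ∑ i, (Z (Function.update a₀ i (a i)) - Z a₀) := by
  refine sub_eq_sum_of_mixed_differences (fun a i j hij x y => ?_) a₀ a
  have key := sub_eq_sub_of_forall_adj (adjacencyGraph_preconnected (hu i))
    (adjacencyGraph_preconnected (hu j))
    (F := fun x y => Z (Function.update (Function.update a i x) j y)) ?_ (a i) x (a j) y
  · simpa [Function.update_comm hij, hij, hij.symm] using key
  · intro x x' y y' hx hy
    set b := Function.update (Function.update a i x) j y with hb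
    have hbi : b i = x := by rw [hb, Function.update_of_ne hij, Function.update_self]
    have hbj : b j = y := by rw [hb, Function.update_self]
    have hb1 : Function.update (Function.update a i x') j y = Function.update b i x' := by
      rw [hb, Function.update_comm hij.symm, Function.update_idem]
    have hb2 : Function.update (Function.update a i x) j y' = Function.update b j y' := by
      rw [hb, Function.update_idem]
    have hb3 : Function.update (Function.update a i x') j y' =
        Function.update (Function.update b i x') j y' := by
      rw [← hb1, Function.update_idem]
    have hb4 : Function.update (Function.update b i x') j y' =
        Function.update (Function.update b j y') i x' := Function.update_comm hij _ _ _
    simp only [hb1, hb2, hb3]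
    obtain ⟨l1, h1⟩ := hZ b i x' (hbi ▸ hx)
    obtain ⟨l2, h2⟩ := hZ b j y' (hbj ▸ hy)
    obtain ⟨l3, h3⟩ := hZ (Function.update b i x') j y' (by
      rw [Function.update_of_ne hij.symm]; exact hbj ▸ hy)
    obtain ⟨l4, h4⟩ := hZ (Function.update b j y') i x' (by
      rw [Function.update_of_ne hij]; exact hbi ▸ hx)
    rw [Function.update_of_ne hij] at h4
    rw [Function.update_of_ne hij.symm] at h3
    rw [hb4, h4, h1]
    rw [hb4] at h3
    ext k θ
    -- Going around the square both ways equates a multiple of the difference for task `i` with one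
    -- for task `j`; by independence both vanish, so parallel sides have equal increments.
    have h5 : centerLift Θ i ((l4 k - l1 k) • payoffDiff (u i) (b i) x') =
        centerLift Θ j ((l3 k - l2 k) • payoffDiff (u j) (b j) y') := by
      rw [map_smul, map_smul]
      funext θ
      have e1 := congrFun (congrFun h1 k) θ
      have e2 := congrFun (congrFun h2 k) θ
      have e3 := congrFun (congrFun h3 k) θ
      have e4 := congrFun (congrFun h4 k) θ
      simp only [Matrix.sub_apply, Matrix.vecMulVec_apply, Pi.smul_apply, smul_eq_mul] at *
      linarith
    have h6 := congrFun (centerLift_eq_zero_of_eq hij h5) θ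
    rw [map_smul, Pi.smul_apply, smul_eq_mul, Pi.zero_apply] at h6
    simp only [Matrix.vecMulVec_apply]
    linarith

end Product

/-! ### Characterization of robust incentivizability -/

section Characterization

variable {ι : Type*} [Fintype ι] [DecidableEq ι] {Θ A : ι → Type*} [∀ i, Fintype (Θ i)]
  [∀ i, Fintype (A i)] [∀ i, Nonempty (Θ i)] {u : ∀ i, A i → Θ i → ℝ} {m : ℕ}
  {X : (∀ i, A i) → Matrix (Fin m) (∀ i, Θ i) ℝ}

theorem centerRows_sum {κ : Type*} (t : Finset κ) (M : κ → Matrix (Fin m) (∀ i, Θ i) ℝ) :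
    centerRows (∑ i ∈ t, M i) = ∑ i ∈ t, centerRows (M i) := by
  ext k θ
  rw [Matrix.sum_apply]
  have h : (∑ i ∈ t, M i) k = ∑ i ∈ t, M i k := Finset.sum_apply _ _ _
  change center ((∑ i ∈ t, M i) k) θ = ∑ i ∈ t, center (M i k) θ
  rw [h, center_sum, Finset.sum_apply]

/-- The centered questions of a robustly incentivizable profile are, up to invertible matrices,
additively separable, with components that vary along edges by multiples of the payoff
differences. -/
theorem RobustlyIncentivizable.exists_separable [Nonempty ι] [Nonempty (∀ i, A i)]
    (hu : ∀ i, NonRedundant (u i)) (hX : RobustlyIncentivizable (totalPayoff u) X) :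
    ∃ (Γ : (∀ i, A i) → Matrix (Fin m) (Fin m) ℝ)
      (f : ∀ i, A i → Matrix (Fin m) (∀ i, Θ i) ℝ), (∀ a, IsUnit (Γ a)) ∧
      (∀ a, centerRows (X a) = Γ a * ∑ i, f i (a i)) ∧
      ∀ i x y, (adjacencyGraph (u i)).Adj x y → ∃ lam : Fin m → ℝ,
        f i y - f i x = Matrix.vecMulVec lam (centerLift Θ i (payoffDiff (u i) x y)) := by
  obtain ⟨Γ, hΓ, hΓX⟩ := hX.exists_sub_eq (nonRedundant_totalPayoff hu)
  have hdet : ∀ a, IsUnit (Γ a).det := fun a => (Matrix.isUnit_iff_isUnit_det _).1 (hΓ a)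
  let Z : (∀ i, A i) → Matrix (Fin m) (∀ i, Θ i) ℝ := fun a => (Γ a)⁻¹ * centerRows (X a)
  have hZ : ∀ (a : ∀ i, A i) (i : ι) (y : A i), (adjacencyGraph (u i)).Adj (a i) y →
      ∃ lam : Fin m → ℝ, Z (Function.update a i y) - Z a =
        Matrix.vecMulVec lam (centerLift Θ i (payoffDiff (u i) (a i) y)) := by
    intro a i y hy
    rw [← payoffDiff_totalPayoff_update]
    exact hΓX _ _ ((adjacencyGraph_totalPayoff_adj_iff hu).2 ⟨i, y, hy, rfl⟩)
  obtain ⟨a₀⟩ := ‹Nonempty (∀ i, A i)›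
  obtain ⟨i₀⟩ := ‹Nonempty ι›
  -- The base value is assigned to the single task `i₀`, so that it enters the sum exactly once.
  refine ⟨Γ, fun i x => (Z (Function.update a₀ i x) - Z a₀) + if i = i₀ then Z a₀ else 0, hΓ,
    fun a => ?_, fun i x y hxy => ?_⟩
  · rw [Finset.sum_add_distrib, ← sub_eq_sum_of_forall_adj hu hZ a₀ a]
    simp [Z, Matrix.mul_nonsing_inv_cancel_left _ _ (hdet a)]
  · have h := hZ (Function.update a₀ i x) i y (by rwa [Function.update_self])
    rw [Function.update_self, Function.update_idem] at h
    obtain ⟨lam, h⟩ := h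
    exact ⟨lam, by rw [← h, add_sub_add_right_eq_sub, sub_sub_sub_cancel_right]⟩

/-- Robust incentivizability implies alignment. The independence along alternating 4-cycles is not
needed, since centered payoff differences of distinct tasks are always independent. -/
theorem RobustlyIncentivizable.taskBlockwiseJointlyAligned (hu : ∀ i, NonRedundant (u i))
    (hcycle : ∀ i, CycleIndependence (u i)) (hX : RobustlyIncentivizable (totalPayoff u) X) :
    TaskBlockwiseJointlyAligned u X := by
  rcases isEmpty_or_nonempty (∀ i, A i) with hA | hA
  · exact ⟨0, fun _ _ => 0, fun _ _ => 0, fun _ => 1, fun a => hA.elim a, fun a => hA.elim a⟩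
  rcases isEmpty_or_nonempty ι with hι | hι
  · refine ⟨0, fun _ _ => 0, fun _ _ => 0, fun _ => 1, fun _ => isUnit_one, fun a z _ => ?_⟩
    rw [Finset.univ_eq_empty, Finset.sum_empty, Matrix.mul_zero]
    ext k θ
    have h : X a k = fun _ => X a k θ := funext fun θ' => congrArg _ (Subsingleton.elim _ _)
    change center (X a k) θ = 0
    rw [h, center_const, Pi.zero_apply]
  obtain ⟨Γ, f, hΓ, hΓf, hf⟩ := hX.exists_separable hu
  have hdet : ∀ a, IsUnit (Γ a).det := fun a => (Matrix.isUnit_iff_isUnit_det _).1 (hΓ a)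
  have hblock := fun (i : ι) (z : Block (adjacencyGraph (u i))) (k : Fin m) =>
    (hcycle i).exists_affine_on_block (hu i) (centerLift_injective i) (f := fun x => f i x k)
      (fun x y hxy => (hf i x y hxy).elim fun lam h => ⟨lam k, congrFun h k⟩) z
  choose σ d hσd using hblock
  refine ⟨fun _ => 1, σ, d, Γ, hΓ, fun a z hz => ?_⟩
  -- The single components need not be centered, but their sum is, so each summand may be centered
  -- without changing it.
  have h1 : ∑ i, f i (a i) = centerRows (∑ i, f i (a i)) := by
    have h2 : ∑ i, f i (a i) = (Γ a)⁻¹ * centerRows (X a) := by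
      rw [hΓf, Matrix.nonsing_inv_mul_cancel_left _ _ (hdet a)]
    rw [h2, centerRows_mul, centerRows_centerRows]
  rw [hΓf, h1, centerRows_sum]
  congr 1
  refine Finset.sum_congr rfl fun i _ => ?_
  ext k θ
  have h2 : center (f i (a i) k) = _ := congrArg center (hσd i (z i) k (a i) (hz i))
  rw [center_add, center_smul, centerLift_center, centerLift_apply, center_center] at h2
  refine (congrFun h2 θ).trans ?_
  rw [one_smul]
  rfl

/-- The components of an aligned profile vary along edges by multiples of the payoff
differences. -/
theorem TaskBlockwiseJointlyAligned.exists_separable [Nonempty (∀ i, A i)]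
    (hX : TaskBlockwiseJointlyAligned u X) :
    ∃ (Γ : (∀ i, A i) → Matrix (Fin m) (Fin m) ℝ)
      (f : ∀ i, A i → Matrix (Fin m) (∀ i, Θ i) ℝ), (∀ a, IsUnit (Γ a)) ∧
      (∀ a, centerRows (X a) = Γ a * ∑ i, f i (a i)) ∧
      ∀ i x y, (adjacencyGraph (u i)).Adj x y → ∃ lam : Fin m → ℝ,
        f i y - f i x = Matrix.vecMulVec lam (centerLift Θ i (payoffDiff (u i) x y)) := by
  obtain ⟨τ, lam, d, Γ, hΓ, hΓX⟩ := hX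
  choose zv hzv using fun i (x : A i) => exists_block_of_vertex (G := adjacencyGraph (u i)) x
  have hdet : ∀ a, IsUnit (Γ a).det := fun a => (Matrix.isUnit_iff_isUnit_det _).1 (hΓ a)
  let F : ∀ i, A i → Block (adjacencyGraph (u i)) → Matrix (Fin m) (∀ i, Θ i) ℝ := fun i x z =>
    τ i • Matrix.vecMulVec (lam i z) (centerLift Θ i (u i x)) + centerRows (d i z)
  have hF : ∀ (a : ∀ i, A i) (z : ∀ i, Block (adjacencyGraph (u i))),
      (∀ i, a i ∈ (z i).1.verts) → centerRows (X a) = Γ a * ∑ i, F i (a i) (z i) := hΓX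
  obtain ⟨a₀⟩ := ‹Nonempty (∀ i, A i)›
  -- Apply the alignment equation twice at the same action profile, changing only the block of task
  -- `i`, and cancel `Γ a`. Thus all blocks meeting at a cut-vertex give the same component there.
  have hindep : ∀ i x z, x ∈ z.1.verts → F i x z = F i x (zv i x) := by
    intro i x z hz
    set a := Function.update a₀ i x with ha
    have hai : a i = x := by rw [ha, Function.update_self]
    have h1 := hF a (fun j => zv j (a j)) fun j => hzv j _
    have h2 := hF a (Function.update (fun j => zv j (a j)) i z) fun j => by
      by_cases hj : j = i
      · subst hj
        rwa [Function.update_self, hai]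
      · rw [Function.update_of_ne hj]
        exact hzv j _
    have h3 := congrArg ((Γ a)⁻¹ * ·) (h2.symm.trans h1)
    simp only [Matrix.nonsing_inv_mul_cancel_left _ _ (hdet a)] at h3
    have h4 := sum_update_sub (fun j w => F j (a j) w) (fun j => zv j (a j)) i z
    rw [h3, sub_self, eq_comm, sub_eq_zero, hai] at h4
    exact h4
  refine ⟨Γ, fun i x => F i x (zv i x), hΓ, fun a => hF a _ fun i => hzv i _, fun i x y hxy => ?_⟩
  obtain ⟨z, hx, hy⟩ := exists_block_of_adj hxy
  refine ⟨τ i • lam i z, ?_⟩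
  change F i y (zv i y) - F i x (zv i x) = _
  rw [← hindep i x z hx, ← hindep i y z hy, payoffDiff, map_sub, centerLift_center,
    centerLift_center]
  simp only [F, add_sub_add_right_eq_sub, ← smul_sub, ← Matrix.vecMulVec_sub,
    Matrix.smul_vecMulVec]

/-- Alignment implies robust incentivizability. -/
theorem TaskBlockwiseJointlyAligned.robustlyIncentivizable (hu : ∀ i, NonRedundant (u i))
    (hcycle : ∀ i, CycleIndependence (u i)) (hX : TaskBlockwiseJointlyAligned u X) :
    RobustlyIncentivizable (totalPayoff u) X := by
  rcases isEmpty_or_nonempty (∀ i, A i) with hA | hA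
  · exact ⟨fun _ => 1, fun _ => isUnit_one, fun t =>
      incentivizable_of_sub_eq (nonRedundant_totalPayoff hu) fun a => hA.elim a⟩
  obtain ⟨Γ, f, hΓ, hΓf, hf⟩ := hX.exists_separable
  let mean : ∀ i, A i → ℝ := fun i x =>
    (∑ θ, liftTask Θ i (u i x) θ) / (Fintype.card (∀ i, Θ i) : ℝ)
  -- Alignment controls questions only up to constants, whereas the score needs increments
  -- proportional to the raw payoff difference. The potential `g` supplies the constants, with the
  -- same edge coefficients applied to the mean payoff.
  have hpot := fun (i : ι) (k : Fin m) =>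
    (hcycle i).exists_weighted_potential (hu i) (centerLift_injective i) (f := fun x => f i x k)
      (fun x y hxy => (hf i x y hxy).elim fun lam h => ⟨lam k, congrFun h k⟩) (mean i)
  choose g hg using hpot
  let h : ∀ i, A i → Matrix (Fin m) (∀ i, Θ i) ℝ := fun i x =>
    f i x + Matrix.vecMulVec (fun k => g i k x) 1
  have hh : ∀ i x y, (adjacencyGraph (u i)).Adj x y → ∃ lam : Fin m → ℝ,
      h i y - h i x = Matrix.vecMulVec lam (liftTask Θ i (u i y - u i x)) := by
    intro i x y hxy
    choose s hs hs' using fun k => hg i k x y hxy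
    refine ⟨s, ?_⟩
    ext k θ
    have e1 := congrFun (hs k) θ
    have e2 := hs' k
    rw [payoffDiff, map_sub, centerLift_center, centerLift_center] at e1
    have e3 := eq_center_add_const (liftTask Θ i (u i x)) θ
    have e4 := eq_center_add_const (liftTask Θ i (u i y)) θ
    simp only [h, Matrix.sub_apply, Matrix.add_apply, Matrix.vecMulVec_apply, Pi.one_apply,
      map_sub, Pi.sub_apply, Pi.smul_apply, smul_eq_mul, mul_one, centerLift_apply] at *
    rw [e3, e4]
    linear_combination e1 + e2
  refine ⟨Γ, hΓ, fun t => ?_⟩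
  -- The shift `t` is the same for all actions and cancels along edges; after multiplication by `Γ
  -- a` it becomes the shift in the robust condition.
  have hY : Incentivizable (totalPayoff u) fun a => ∑ i, h i (a i) + t := by
    refine incentivizable_of_sub_eq (nonRedundant_totalPayoff hu) fun a b hab => ?_
    obtain ⟨i, y, hy, rfl⟩ := (adjacencyGraph_totalPayoff_adj_iff hu).1 hab
    obtain ⟨lam, hlam⟩ := hh i _ _ hy
    exact ⟨lam, by
      rw [totalPayoff_update_sub, ← hlam, add_sub_add_right_eq_sub, sum_update_sub]⟩
  -- The additive vector restores the row means of `X a` and removes the constants `g`, transformed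
  -- by `Γ a`.
  have := hY.mul_add hΓ fun a k =>
    (∑ θ, X a k θ) / (Fintype.card (∀ i, Θ i) : ℝ) - (Γ a *ᵥ fun k => ∑ i, g i k (a i)) k
  convert this using 2 with a
  have h1 : ∑ i, h i (a i) = ∑ i, f i (a i) + Matrix.vecMulVec (fun k => ∑ i, g i k (a i)) 1 := by
    simp only [h, Finset.sum_add_distrib, add_right_inj]
    ext k θ
    simp [Matrix.sum_apply, Matrix.vecMulVec_apply]
  rw [h1, Matrix.mul_add, Matrix.mul_add, ← hΓf, Matrix.mul_vecMulVec]
  ext k θ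
  have h2 : X a k θ = centerRows (X a) k θ + _ := eq_center_add_const (X a k) θ
  simp only [Matrix.add_apply, Matrix.vecMulVec_apply, Pi.one_apply, mul_one, h2]
  ring

end Characterization

end

theorem mainTheorem4 {ι : Type*} [Fintype ι] [DecidableEq ι] {Θ A : ι → Type*}
    [∀ i, Fintype (Θ i)] [∀ i, Fintype (A i)]
    (hΘ : ∀ i, 2 ≤ Fintype.card (Θ i))
    (u : ∀ i, A i → Θ i → ℝ)
    (hu : ∀ i, NonRedundant (u i))
    (hsquare : SquareIndependence u)
    (hcycle : ∀ i, CycleIndependence (u i))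
    (m : ℕ) (X : (∀ i, A i) → Matrix (Fin m) (∀ i, Θ i) ℝ) :
    RobustlyIncentivizable (totalPayoff u) X ↔ TaskBlockwiseJointlyAligned u X := by
  have : ∀ i, Nonempty (Θ i) := fun i => Fintype.card_pos_iff.1 (two_pos.trans_le (hΘ i))
  exact ⟨fun h => h.taskBlockwiseJointlyAligned hu hcycle,
    fun h => h.robustlyIncentivizable hu hcycle⟩
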